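/- Fix a prime $p$. For a commutative ring $R$ of characteristic $p$ write $R^p$ for the image of the Frobenius $F_R$. A finite tuple $x=(x_1,\dots,x_n)$ of elements of $R$ (repetitions allowed, $n\ge 0$) is a tuple of $p$-generators of $R$ if $R=R^p[x_1,\dots,x_n]$, and it is a $p$-basis of $R$ if moreover the family of monomials $x_1^{b_1}\cdots x_n^{b_n}$, $0\le b_i\le p-1$, indexed by the exponents $(b_1,\dots,b_n)$, is linearly independent over $R^p$. Let $\operatorname{Ring}^{p\text{-gens}}$ be the category of pairs $(R;x)$ where $R$ is an $F$-finite Noetherian ring of characteristic $p$ and $x$ is a finite tuple of $p$-generators of $R$; a morphism $(R;x_1,\dots,x_n)\to(S;y_1,\dots,y_m)$ is a ring homomorphism $\psi\colon R\to S$ together with a map of indices $\psi'\colon\{1,\dots,n\}\to\{1,\dots,m\}$ such that $\psi(x_i)=y_{\psi'(i)}$ for all $i$. Let $\iota\colon\operatorname{RegRing}^{p\text{-basis}}\subseteq\operatorname{Ring}^{p\text{-gens}}$ be the inclusion of the full subcategory of those pairs $(R;x)$ such that $R$ is regular and $x$ is a $p$-basis of $R$. For $(R;x)$ put $R'=R[X_1,\dots,X_n]/(X_1^p-x_1,\dots,X_n^p-x_n)$,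 let $x'$ be the tuple of the classes of the $X_i$, and let $\phi\colon R'\to R$ be the ring homomorphism with $\phi(r)=r^p$ for $r\in R$ and $\phi(x_i')=x_i$. Set $(R_0;x^{(0)})=(R;x)$ and $(R_{i+1};x^{(i+1)})=(R_i';(x^{(i)})')$, and define \[ G(R;x)=\varprojlim\big(\cdots\xrightarrow{\phi}R_2\xrightarrow{\phi}R_1\xrightarrow{\phi}R_0=R\big), \] with the tuple $x_\infty$ of elements of $G(R;x)$ determined by the tuples $x^{(i)}$, and with the projection $\phi_0\colon G(R;x)\to R$. A morphism $(\psi,\psi')\colon(R;x)\to(S;y)$ induces ring homomorphisms $\psi_i\colon R_i\to S_i$ ($\psi_0=\psi$, and $\psi_{i+1}$ is $\psi_i$ on coefficients and sends the class of $X_k$ to the class of $Y_{\psi'(k)}$), and in the limit a ring homomorphism $G(R;x)\to G(S;y)$, which together with $\psi'$ is a morphism $(G(R;x);x_\infty)\to(G(S;y);y_\infty)$. Then for every $(R;x)$ in $\operatorname{Ring}^{p\text{-gens}}$ the ring $G(R;x)$ is $F$-finite, Noetherian and regular, of characteristic $p$, and $x_\infty$ is a $p$-basis of it, so that $(R;x)\mapsto(G(R;x);x_\infty)$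 is a functor \[ G\colon\operatorname{Ring}^{p\text{-gens}}\to\operatorname{RegRing}^{p\text{-basis}} . \] This functor is right adjoint to the inclusion $\iota$, by an adjunction whose unit $\operatorname{id}\to G\circ\iota$ is an isomorphism and whose counit $\iota\circ G\to\operatorname{id}$ is given at $(R;x)$ by $\phi_0\colon G(R;x)\to R$ and the bijection $x_\infty\leftrightarrow x$; the ring homomorphism $\phi_0$ is surjective. In particular, $G$ is essentially surjective. -/

import Mathlib

open CategoryTheory

universe u

noncomputable section

/-- A commutative ring `R` of characteristic `p` with a finite tuple `x = (x₁, …, xₙ)` of elements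
of `R` (repeated entries are allowed). -/
structure TupledRing (p : ℕ) where
  carrier : Type u
  [commRing : CommRing carrier]
  [charP : CharP carrier p]
  len : ℕ
  gen : Fin len → carrier

namespace TupledRing

attribute [instance] TupledRing.commRing TupledRing.charP

variable {p : ℕ}

/-- A morphism `(R; x) ⟶ (S; y)`: a ring map `R → S` with a map of the entries of the tuples (that
is, of their indices) which is compatible with it. -/
@[ext]
structure Hom (X Y : TupledRing.{u} p) where
  ringHom : X.carrier →+* Y.carrier
  idx : Fin X.len → Fin Y.len
  map_gen : ∀ i, ringHom (X.gen i) = Y.gen (idx i)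

instance : Category (TupledRing.{u} p) where
  Hom := Hom
  id X := ⟨RingHom.id _, id, fun _ => rfl⟩
  comp f g := ⟨g.ringHom.comp f.ringHom, g.idx ∘ f.idx, fun i => by
    simp [f.map_gen, g.map_gen]⟩

@[ext]
theorem hom_ext {X Y : TupledRing.{u} p} {f g : X ⟶ Y} (h : f.ringHom = g.ringHom)
    (h' : f.idx = g.idx) : f = g :=
  Hom.ext h h'

@[simp] theorem id_ringHom (X : TupledRing.{u} p) : Hom.ringHom (𝟙 X) = RingHom.id _ := rfl

@[simp] theorem id_idx (X : TupledRing.{u} p) : Hom.idx (𝟙 X) = id := rfl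

@[simp] theorem comp_ringHom {X Y Z : TupledRing.{u} p} (f : X ⟶ Y) (g : Y ⟶ Z) :
    (f ≫ g).ringHom = g.ringHom.comp f.ringHom := rfl

@[simp] theorem comp_idx {X Y Z : TupledRing.{u} p} (f : X ⟶ Y) (g : Y ⟶ Z) :
    (f ≫ g).idx = g.idx ∘ f.idx := rfl

section Properties

variable [Fact p.Prime]

/-- The subring `R^p` of `p`-th powers, the image of Frobenius. -/
abbrev powSubring (X : TupledRing.{u} p) : Subring X.carrier := (frobenius X.carrier p).range

/-- `x` is a `p`-generating tuple of `R`: `R = R^p[x₁, …, xₙ]`. -/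
def IsPGenerating (X : TupledRing.{u} p) : Prop :=
  Algebra.adjoin X.powSubring (Set.range X.gen) = ⊤

/-- `x` is `p`-independent: the monomials `x₁^b₁ ⋯ xₙ^bₙ` with `0 ≤ bᵢ ≤ p - 1`, as a family
indexed by the exponents, are linearly independent over `R^p`. -/
def IsPIndependent (X : TupledRing.{u} p) : Prop :=
  LinearIndependent X.powSubring
    (fun b : Fin X.len → Fin p => ∏ i, X.gen i ^ (b i : ℕ))

/-- `x` is a `p`-basis of `R`. -/
def IsPBasis (X : TupledRing.{u} p) : Prop :=
  X.IsPIndependent ∧ X.IsPGenerating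

variable (p) in
/-- `R` is Noetherian and `F`-finite, and `x` is a tuple of `p`-generators of `R`. -/
def isPGens : ObjectProperty (TupledRing.{u} p) := fun X =>
  IsNoetherianRing X.carrier ∧ (frobenius X.carrier p).Finite ∧ X.IsPGenerating

end Properties

section RootStep

/-- The ideal `(X₁^p - x₁, …, Xₙ^p - xₙ)` of `R[X₁, …, Xₙ]`. -/
abbrev rootIdeal (X : TupledRing.{u} p) : Ideal (MvPolynomial (Fin X.len) X.carrier) :=
  Ideal.span (Set.range fun i => MvPolynomial.X i ^ p - MvPolynomial.C (X.gen i))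

/-- The ring `R' = R[X₁, …, Xₙ] / (X₁^p - x₁, …, Xₙ^p - xₙ)`. -/
abbrev RootRing (X : TupledRing.{u} p) : Type u :=
  MvPolynomial (Fin X.len) X.carrier ⧸ X.rootIdeal

/-- The class of the variable `Xᵢ` in `R'`. -/
abbrev rootGen (X : TupledRing.{u} p) (i : Fin X.len) : X.RootRing :=
  Ideal.Quotient.mk X.rootIdeal (MvPolynomial.X i)

theorem rootGen_pow (X : TupledRing.{u} p) (i : Fin X.len) :
    X.rootGen i ^ p = Ideal.Quotient.mk X.rootIdeal (MvPolynomial.C (X.gen i)) := by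
  rw [rootGen, ← map_pow, Ideal.Quotient.eq]
  exact Ideal.subset_span ⟨i, rfl⟩

theorem rootRing_hom_ext {X : TupledRing.{u} p} {A : Type*} [CommRing A] {f g : X.RootRing →+* A}
    (hC : ∀ r, f (Ideal.Quotient.mk _ (MvPolynomial.C r)) =
      g (Ideal.Quotient.mk _ (MvPolynomial.C r)))
    (hX : ∀ i, f (X.rootGen i) = g (X.rootGen i)) : f = g :=
  Ideal.Quotient.ringHom_ext (MvPolynomial.ringHom_ext hC hX)

/-- The ring map `R' → A` which is `f` on coefficients and sends the class of `Xᵢ` to `aᵢ`. -/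
def rootLift (X : TupledRing.{u} p) {A : Type*} [CommRing A] (f : X.carrier →+* A)
    (a : Fin X.len → A) (h : ∀ i, a i ^ p = f (X.gen i)) : X.RootRing →+* A :=
  Ideal.Quotient.lift X.rootIdeal (MvPolynomial.eval₂Hom f a) fun q hq => by
    have hle : X.rootIdeal ≤ RingHom.ker (MvPolynomial.eval₂Hom f a) := by
      rw [Ideal.span_le]
      rintro _ ⟨i, rfl⟩
      simp [RingHom.mem_ker, h]
    exact hle hq

@[simp] theorem rootLift_C (X : TupledRing.{u} p) {A : Type*} [CommRing A] (f : X.carrier →+* A)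
    (a : Fin X.len → A) (h : ∀ i, a i ^ p = f (X.gen i)) (r : X.carrier) :
    X.rootLift f a h (Ideal.Quotient.mk _ (MvPolynomial.C r)) = f r :=
  (Ideal.Quotient.lift_mk _ _ _).trans (MvPolynomial.eval₂Hom_C _ _ _)

@[simp] theorem rootLift_gen (X : TupledRing.{u} p) {A : Type*} [CommRing A] (f : X.carrier →+* A)
    (a : Fin X.len → A) (h : ∀ i, a i ^ p = f (X.gen i)) (i : Fin X.len) :
    X.rootLift f a h (X.rootGen i) = a i :=
  (Ideal.Quotient.lift_mk _ _ _).trans (MvPolynomial.eval₂Hom_X' _ _ _)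

variable [Fact p.Prime]

/-- The ring map `φ : R' → R` which is `r ↦ r^p` on coefficients and sends the class of `Xᵢ`
to `xᵢ`. -/
def rootPhi (X : TupledRing.{u} p) : X.RootRing →+* X.carrier :=
  X.rootLift (frobenius X.carrier p) X.gen fun _ => rfl

theorem rootPhi_C (X : TupledRing.{u} p) (r : X.carrier) :
    X.rootPhi (Ideal.Quotient.mk _ (MvPolynomial.C r)) = r ^ p :=
  X.rootLift_C _ _ _ r

theorem rootPhi_gen (X : TupledRing.{u} p) (i : Fin X.len) :
    X.rootPhi (X.rootGen i) = X.gen i :=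
  X.rootLift_gen _ _ _ i

theorem charP_of_ringHom {A B : Type*} [CommRing A] [CommRing B] [CharP B p] (f : A →+* B)
    (h : (p : A) = 0) : CharP A p := by
  have : Nontrivial B := CharP.nontrivial_of_char_ne_one (Fact.out : p.Prime).ne_one
  have : Nontrivial A := f.domain_nontrivial
  exact (CharP.charP_iff_prime_eq_zero Fact.out).2 h

instance (X : TupledRing.{u} p) : CharP X.RootRing p :=
  charP_of_ringHom X.rootPhi <| by
    have h := congrArg
      ((Ideal.Quotient.mk X.rootIdeal).comp (MvPolynomial.C (σ := Fin X.len)))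
      (CharP.cast_eq_zero X.carrier p)
    rwa [map_natCast, map_zero] at h

/-- `(R'; x')`, where `x'` is the tuple of the classes of the variables. -/
abbrev root (X : TupledRing.{u} p) : TupledRing.{u} p where
  carrier := X.RootRing
  len := X.len
  gen := X.rootGen

/-- `φ` as a morphism `(R'; x') ⟶ (R; x)`. -/
def phi (X : TupledRing.{u} p) : X.root ⟶ X where
  ringHom := X.rootPhi
  idx := id
  map_gen i := X.rootPhi_gen i

/-- A morphism `(R; x) ⟶ (S; y)` induces `(R'; x') ⟶ (S'; y')`. -/
def rootMap {X Y : TupledRing.{u} p} (f : X ⟶ Y) : X.root ⟶ Y.root where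
  ringHom := X.rootLift
    ((Ideal.Quotient.mk Y.rootIdeal).comp (MvPolynomial.C.comp f.ringHom))
    (fun i => Y.rootGen (f.idx i)) fun i => by
      rw [rootGen_pow]
      simp [f.map_gen]
  idx := f.idx
  map_gen i := by simp

theorem rootMap_C {X Y : TupledRing.{u} p} (f : X ⟶ Y) (r : X.carrier) :
    (rootMap f).ringHom (Ideal.Quotient.mk _ (MvPolynomial.C r)) =
      Ideal.Quotient.mk Y.rootIdeal (MvPolynomial.C (f.ringHom r)) := by
  simp [rootMap]

theorem rootMap_gen {X Y : TupledRing.{u} p} (f : X ⟶ Y) (i : Fin X.len) :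
    (rootMap f).ringHom (X.rootGen i) = Y.rootGen (f.idx i) := by
  simp [rootMap]

theorem rootMap_id (X : TupledRing.{u} p) : rootMap (𝟙 X) = 𝟙 X.root := by
  ext1
  · apply rootRing_hom_ext <;> intro <;> simp [rootMap]
  · rfl

theorem rootMap_comp {X Y Z : TupledRing.{u} p} (f : X ⟶ Y) (g : Y ⟶ Z) :
    rootMap (f ≫ g) = rootMap f ≫ rootMap g := by
  ext1
  · apply rootRing_hom_ext <;> intro <;> simp [rootMap]
  · rfl

theorem rootMap_phi {X Y : TupledRing.{u} p} (f : X ⟶ Y) :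
    rootMap f ≫ Y.phi = X.phi ≫ f := by
  ext1
  · apply rootRing_hom_ext
    · intro r
      refine (congrArg Y.rootPhi (rootMap_C f r)).trans ((Y.rootPhi_C _).trans ?_)
      exact (map_pow f.ringHom r p).symm.trans (congrArg f.ringHom (X.rootPhi_C r)).symm
    · intro i
      refine (congrArg Y.rootPhi (rootMap_gen f i)).trans ((Y.rootPhi_gen _).trans ?_)
      exact (f.map_gen i).symm.trans (congrArg f.ringHom (X.rootPhi_gen i)).symm
  · rfl

end RootStep

section Limit

variable [Fact p.Prime]

/-- `(R₀; x) = (R; x)` and `R_{i+1} = R_i'`, each with its tuple. -/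
def stage (X : TupledRing.{u} p) : ℕ → TupledRing.{u} p
  | 0 => X
  | i + 1 => (X.stage i).root

/-- The transition map `φ : R_{i+1} → R_i`. -/
def transition (X : TupledRing.{u} p) (i : ℕ) : X.stage (i + 1) ⟶ X.stage i :=
  (X.stage i).phi

/-- The tuples of all `R_i` have the same indices as `x`. -/
def stageIdx (X : TupledRing.{u} p) : (i : ℕ) → Fin X.len → Fin (X.stage i).len
  | 0 => id
  | i + 1 => X.stageIdx i

def stageMap {X Y : TupledRing.{u} p} (f : X ⟶ Y) : (i : ℕ) → (X.stage i ⟶ Y.stage i)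
  | 0 => f
  | i + 1 => rootMap (stageMap f i)

theorem stageMap_id (X : TupledRing.{u} p) (i : ℕ) : stageMap (𝟙 X) i = 𝟙 (X.stage i) := by
  induction i with
  | zero => rfl
  | succ i ih => exact (congrArg rootMap ih).trans (rootMap_id _)

theorem stageMap_comp {X Y Z : TupledRing.{u} p} (f : X ⟶ Y) (g : Y ⟶ Z) (i : ℕ) :
    stageMap (f ≫ g) i = stageMap f i ≫ stageMap g i := by
  induction i with
  | zero => rfl
  | succ i ih => exact (congrArg rootMap ih).trans (rootMap_comp _ _)

theorem stageMap_transition {X Y : TupledRing.{u} p} (f : X ⟶ Y) (i : ℕ) :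
    stageMap f (i + 1) ≫ Y.transition i = X.transition i ≫ stageMap f i :=
  rootMap_phi _

theorem stageMap_idx {X Y : TupledRing.{u} p} (f : X ⟶ Y) (i : ℕ) (j : Fin X.len) :
    (stageMap f i).idx (X.stageIdx i j) = Y.stageIdx i (f.idx j) := by
  induction i with
  | zero => rfl
  | succ i ih => exact ih

/-- The inverse limit of `⋯ → R_2 → R_1 → R_0 = R` along the maps `φ`, as the ring of compatible
sequences. -/
def gabberRing (X : TupledRing.{u} p) : Subring (∀ i, (X.stage i).carrier) where
  carrier := {a | ∀ i, (X.transition i).ringHom (a (i + 1)) = a i}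
  mul_mem' ha hb i := by simp [ha i, hb i]
  one_mem' i := by simp
  add_mem' ha hb i := by simp [ha i, hb i]
  zero_mem' i := by simp
  neg_mem' ha i := by simp [ha i]

/-- The natural map `φ_i : G(R; x) → R_i`. -/
def gabberProj (X : TupledRing.{u} p) (i : ℕ) : X.gabberRing →+* (X.stage i).carrier :=
  (Pi.evalRingHom _ i).comp X.gabberRing.subtype

/-- The tuple `x_∞` of `G(R; x)`. -/
def gabberGen (X : TupledRing.{u} p) (j : Fin X.len) : X.gabberRing :=
  ⟨fun i => (X.stage i).gen (X.stageIdx i j), fun i =>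
    (X.transition i).map_gen (X.stageIdx (i + 1) j)⟩

instance (X : TupledRing.{u} p) : CharP X.gabberRing p :=
  charP_of_ringHom (B := X.carrier) (X.gabberProj 0) <| by
    ext i
    simp [CharP.cast_eq_zero]

/-- The pair `(G(R; x), x_∞)`. -/
abbrev gabber (X : TupledRing.{u} p) : TupledRing.{u} p where
  carrier := X.gabberRing
  len := X.len
  gen := X.gabberGen

/-- The morphism `(G(R; x), x_∞) ⟶ (G(S; y), y_∞)` induced by `(R; x) ⟶ (S; y)`. -/
def gabberMap {X Y : TupledRing.{u} p} (f : X ⟶ Y) : X.gabber ⟶ Y.gabber where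
  ringHom :=
    ((RingHom.pi fun i => (stageMap f i).ringHom.comp (X.gabberProj i)).codRestrict Y.gabberRing
      fun a i => by
        have h := RingHom.congr_fun (congrArg Hom.ringHom (stageMap_transition f i)) (a.1 (i + 1))
        exact h.trans (congrArg _ (a.2 i)))
  idx := f.idx
  map_gen j := by
    refine Subtype.ext (funext fun i => ?_)
    exact ((stageMap f i).map_gen _).trans (congrArg _ (stageMap_idx f i j))

/-- Gabber's construction as a functor on rings of characteristic `p` with a tuple. -/
def gabberFunctor (p : ℕ) [Fact p.Prime] : TupledRing.{u} p ⥤ TupledRing.{u} p where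
  obj X := X.gabber
  map f := gabberMap f
  map_id X := by
    refine hom_ext (RingHom.ext fun a => Subtype.ext (funext fun i => ?_)) rfl
    exact RingHom.congr_fun (congrArg Hom.ringHom (stageMap_id X i)) (a.1 i)
  map_comp f g := by
    refine hom_ext (RingHom.ext fun a => Subtype.ext (funext fun i => ?_)) rfl
    exact RingHom.congr_fun (congrArg Hom.ringHom (stageMap_comp f g i)) (a.1 i)

/-- The map `φ_0 : G(R; x) → R` as a morphism, with the bijection `x_∞ ↔ x` on tuples. -/
def gabberCounit (X : TupledRing.{u} p) : X.gabber ⟶ X where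
  ringHom := X.gabberProj 0
  idx := id
  map_gen _ := rfl

end Limit

end TupledRing

section Categories

variable (p : ℕ) [Fact p.Prime]

/-- The category of pairs `(R; x)` where `R` is an `F`-finite Noetherian ring of characteristic `p`
and `x` is a finite tuple of `p`-generators of `R`. -/
abbrev RingPGens : Type (u + 1) := (TupledRing.isPGens.{u} p).FullSubcategory

/-- The pairs `(R; x)` where `R` is regular and `x` is a `p`-basis of `R`. -/
def isRegularPBasis : ObjectProperty (RingPGens.{u} p) := fun X =>
  IsRegularRing X.obj.carrier ∧ X.obj.IsPBasis

/-- The full subcategory of pairs `(R; x)` where `R` is regular and `x` is a `p`-basis of `R`. -/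
abbrev RegRingPBasis : Type (u + 1) := (isRegularPBasis.{u} p).FullSubcategory

variable {p}

/-- Gabber's construction as a functor from rings with `p`-generators to rings with `p`-generators,
provided that it takes values there. -/
def gabberPGens
    (h : ∀ X : RingPGens.{u} p, TupledRing.isPGens.{u} p X.obj.gabber) :
    RingPGens.{u} p ⥤ RingPGens.{u} p :=
  (TupledRing.isPGens.{u} p).lift
    ((TupledRing.isPGens.{u} p).ι ⋙ TupledRing.gabberFunctor.{u} p) h

/-- Gabber's construction as a functor from rings with `p`-generators to regular rings with
`p`-basis, provided that it takes values there. -/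
def gabberReg
    (h : ∀ X : RingPGens.{u} p, TupledRing.isPGens.{u} p X.obj.gabber)
    (h' : ∀ X : RingPGens.{u} p, isRegularPBasis.{u} p ⟨X.obj.gabber, h X⟩) :
    RingPGens.{u} p ⥤ RegRingPBasis.{u} p :=
  (isRegularPBasis.{u} p).lift (gabberPGens h) h'

end Categories

end

/-! The ring `R'` is free over `R` on the monomials in the adjoined roots with exponents below `p`,
and the coefficient map `R → R'` and `φ : R' → R` compose to Frobenius in either order. In these
coordinates the next map `R'' → R'` is `φ : R' → R` applied to each coordinate, so surjectivity,
injectivity and control of the kernel climb the tower. In the limit, the coordinates over `R_i` of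
the components in `R_{i+1}` fit together, and `G` is free over itself via Frobenius on the monomials
in `x_∞` (`gabber_expand_bijective`). This gives `F`-finiteness and the `p`-basis.

Noetherian: `G` is complete for the kernels of `G → R_m`. The kernel of `R_{i+1} → R_i` is generated
by `p^i`-th powers of compatible elements (`ker_transition_le`), so successive approximation shows
that `ker (G → R)` is finitely generated. Its powers tend to zero and its quotient `R` is
Noetherian, so the argument with leading forms applies (`IsCompleteFiltration.isNoetherianRing`).

Regular: freeness via Frobenius passes to localizations, so let `A` be local with maximal ideal `m`,
dimension `d`, and Frobenius of rank `p^n`. Adjoining the `x_i` to `A^p` one at a time either adds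
one generator of `m` modulo `m^2` or enlarges the residue image by degree `p`. Hence `p^n = p^t g`,
where `t` elements generate `m` and `g` elements span the residue field over its `p`-th powers.
Counting generators modulo the extension of `m` along the `e`-th Frobenius gives `p^(ne) ≤ D (p^d
g)^e` for all `e`, so `t ≤ d` and `A` is regular (`isRegularLocalRing_of_expand_bijective`).

Adjunction: regular rings are reduced, so a `p`-basis makes `φ`, and with it the whole tower,
bijective; then `G(S; y) → S` is an isomorphism, whose inverse is the unit. The triangle on the side
of `G` follows because a map from a `p`-generated ring to `G` is determined by its projection to `R`
(`hom_gabber_ext`). -/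

noncomputable section

namespace TupledRing

variable {p : ℕ}

/-! ### Expansions in restricted monomials -/

section Expand

/-- The monomial `x^b` with exponents less than `p` in a tuple of elements of a ring. -/
def restrictedMonomial {A : Type*} [CommRing A] {n : ℕ} (x : Fin n → A) (b : Fin n → Fin p) : A :=
  ∏ i, x i ^ (b i : ℕ)

theorem map_restrictedMonomial {A B : Type*} [CommRing A] [CommRing B] {n : ℕ} (f : A →+* B)
    (x : Fin n → A) (b : Fin n → Fin p) :
    f (restrictedMonomial x b) = restrictedMonomial (fun i => f (x i)) b := by
  simp [restrictedMonomial]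

/-- The element of `B` with coordinates `c` with respect to restricted monomials. -/
def expand {A B : Type*} [CommRing A] [CommRing B] {n : ℕ} (f : A →+* B) (x : Fin n → B)
    (c : (Fin n → Fin p) → A) : B :=
  ∑ b, f (c b) * restrictedMonomial x b

theorem expand_sub {A B : Type*} [CommRing A] [CommRing B] {n : ℕ} (f : A →+* B) (x : Fin n → B)
    (c d : (Fin n → Fin p) → A) : expand f x (c - d) = expand f x c - expand f x d := by
  simp [expand, sub_mul]

theorem map_expand {A B A' B' : Type*} [CommRing A] [CommRing B] [CommRing A'] [CommRing B']
    {n : ℕ} (f : A →+* B) (x : Fin n → B) (f' : A' →+* B') (g : B →+* B') (h : A → A')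
    (hgh : ∀ a, g (f a) = f' (h a)) (c : (Fin n → Fin p) → A) :
    g (expand f x c) = expand f' (fun i => g (x i)) (fun b => h (c b)) := by
  simp [expand, map_restrictedMonomial, hgh]

theorem expand_injective_of_zero {A B : Type*} [CommRing A] [CommRing B] {n : ℕ} (f : A →+* B)
    (x : Fin n → B) (h : ∀ c : (Fin n → Fin p) → A, expand f x c = 0 → c = 0) :
    Function.Injective (expand (p := p) f x) := by
  intro c d hcd
  exact sub_eq_zero.1 (h _ (by rw [expand_sub, hcd, sub_self]))

end Expand

/-! ### The free basis of `R'` over `R`, and `φ` in coordinates -/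

section RootBasis

/-- The coefficient map `R → R'`. -/
def rootC (X : TupledRing.{u} p) : X.carrier →+* X.RootRing :=
  (Ideal.Quotient.mk X.rootIdeal).comp MvPolynomial.C

theorem rootGen_pow_eq (X : TupledRing.{u} p) (i : Fin X.len) :
    X.rootGen i ^ p = X.rootC (X.gen i) :=
  X.rootGen_pow i

variable [Fact p.Prime]

/-- The remainders modulo `p` of the exponents of a monomial. -/
def expMod {n : ℕ} (d : Fin n →₀ ℕ) : Fin n → Fin p :=
  fun i => ⟨d i % p, Nat.mod_lt _ (Fact.out : p.Prime).pos⟩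

/-- The coordinates of a polynomial, considered as an element of `R'`, with respect to the
restricted monomials. -/
def rootCoord (X : TupledRing.{u} p) :
    MvPolynomial (Fin X.len) X.carrier →ₗ[X.carrier] ((Fin X.len → Fin p) → X.carrier) :=
  (MvPolynomial.basisMonomials _ _).constr X.carrier fun d =>
    Pi.single (expMod d) (∏ i, X.gen i ^ (d i / p))

theorem rootCoord_monomial (X : TupledRing.{u} p) (d : Fin X.len →₀ ℕ) (a : X.carrier) :
    X.rootCoord (MvPolynomial.monomial d a) =
      a • Pi.single (expMod d) (∏ i, X.gen i ^ (d i / p)) := by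
  have h : MvPolynomial.monomial d a = a • MvPolynomial.basisMonomials _ X.carrier d := by
    simp [MvPolynomial.smul_monomial]
  rw [h, map_smul, rootCoord, Module.Basis.constr_basis]

/-- Multiplying a monomial by `X_i^p` keeps all remainders of exponents modulo `p` and raises the
`i`-th quotient by one, which has the same effect on coordinates as multiplying by `x_i`. -/
theorem rootCoord_mul_relation (X : TupledRing.{u} p) (i : Fin X.len)
    (r : MvPolynomial (Fin X.len) X.carrier) :
    X.rootCoord (r * (MvPolynomial.X i ^ p - MvPolynomial.C (X.gen i))) = 0 := by
  induction r using MvPolynomial.induction_on' with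
  | monomial d a =>
    have hp : 0 < p := (Fact.out : p.Prime).pos
    have h : MvPolynomial.monomial d a * (MvPolynomial.X i ^ p - MvPolynomial.C (X.gen i)) =
        MvPolynomial.monomial (d + Finsupp.single i p) a -
          MvPolynomial.monomial d (a * X.gen i) := by
      rw [mul_sub, MvPolynomial.X_pow_eq_monomial, MvPolynomial.monomial_mul, mul_one,
        mul_comm _ (MvPolynomial.C _), MvPolynomial.C_mul_monomial, mul_comm a]
    have h1 : (expMod (d + Finsupp.single i p) : Fin X.len → Fin p) = expMod d := by
      funext k
      apply Fin.ext
      by_cases hk : i = k <;> simp [expMod, hk]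
    have h2 : ∏ k, X.gen k ^ ((d + Finsupp.single i p) k / p) =
        X.gen i * ∏ k, X.gen k ^ (d k / p) := by
      have : ∀ k, X.gen k ^ ((d + Finsupp.single i p) k / p) =
          (if k = i then X.gen i else 1) * X.gen k ^ (d k / p) := by
        intro k
        by_cases hk : k = i
        · subst hk
          simp [Nat.add_div_right _ hp, pow_succ, mul_comm]
        · simp [hk]
      rw [Finset.prod_congr rfl fun k _ => this k, Finset.prod_mul_distrib]
      simp
    rw [h, map_sub, rootCoord_monomial, rootCoord_monomial, h1, h2, mul_smul, ← smul_eq_mul,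
      Pi.single_smul' _ (X.gen i), sub_self]
  | add f g hf hg => rw [add_mul, map_add, hf, hg, add_zero]

/-- This lets the coordinates descend to `R'`, which yields the linear independence of the
restricted monomials. The induction carries an arbitrary multiplier `r` because `rootCoord` is only
`R`-linear. -/
theorem rootCoord_eq_zero (X : TupledRing.{u} p) {q : MvPolynomial (Fin X.len) X.carrier}
    (hq : q ∈ X.rootIdeal) : X.rootCoord q = 0 := by
  have h : ∀ r, X.rootCoord (r * q) = 0 := by
    refine Submodule.span_induction (p := fun q _ => ∀ r, X.rootCoord (r * q) = 0)
      ?_ ?_ ?_ ?_ hq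
    · rintro _ ⟨i, rfl⟩ r
      exact X.rootCoord_mul_relation i r
    · simp
    · intro f g _ _ hf hg r
      rw [mul_add, map_add, hf, hg, add_zero]
    · intro a f _ hf r
      rw [smul_eq_mul, ← mul_assoc, hf]
  simpa using h 1

theorem expand_rootCoord (X : TupledRing.{u} p) (q : MvPolynomial (Fin X.len) X.carrier) :
    expand X.rootC X.rootGen (X.rootCoord q) = Ideal.Quotient.mk X.rootIdeal q := by
  induction q using MvPolynomial.induction_on' with
  | monomial d a =>
    rw [rootCoord_monomial, expand, Finset.sum_eq_single (expMod d)]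
    · have h : ∀ i, X.rootGen i ^ d i =
          X.rootC (X.gen i ^ (d i / p)) * X.rootGen i ^ (d i % p) := by
        intro i
        rw [map_pow, ← rootGen_pow_eq, ← pow_mul, ← pow_add, Nat.div_add_mod]
      rw [MvPolynomial.monomial_eq, map_mul, Finsupp.prod_fintype _ _ (by simp), map_prod]
      simp only [map_pow]
      simp only [h, Finset.prod_mul_distrib, ← map_prod]
      simp [restrictedMonomial, expMod, rootC, mul_assoc]
    · intro b _ hb
      simp [Pi.single_eq_of_ne hb]
    · simp
  | add f g hf hg =>
    rw [map_add, map_add, ← hf, ← hg]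
    simp [expand, add_mul, Finset.sum_add_distrib]

theorem rootCoord_expand (X : TupledRing.{u} p) (c : (Fin X.len → Fin p) → X.carrier) :
    X.rootCoord (expand MvPolynomial.C MvPolynomial.X c) = c := by
  have h : ∀ b : Fin X.len → Fin p, MvPolynomial.C (c b) * restrictedMonomial MvPolynomial.X b =
      MvPolynomial.monomial (Finsupp.equivFunOnFinite.symm fun i => (b i : ℕ)) (c b) := by
    intro b
    rw [MvPolynomial.monomial_eq, Finsupp.prod_fintype _ _ (by simp)]
    rfl
  have h' : ∀ b : Fin X.len → Fin p, (expMod (Finsupp.equivFunOnFinite.symm fun i => (b i : ℕ)) :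
      Fin X.len → Fin p) = b := by
    intro b
    funext i
    apply Fin.ext
    simpa [expMod] using Nat.mod_eq_of_lt (b i).2
  have h'' : ∀ b : Fin X.len → Fin p, ∀ i, (b i : ℕ) / p = 0 := fun b i =>
    Nat.div_eq_of_lt (b i).2
  simp only [expand, h, map_sum, rootCoord_monomial, h']
  funext b
  simp [h'', Finset.sum_apply, Pi.single_apply]

/-- `R'` is free over `R` on the restricted monomials in the classes of the variables. -/
theorem expand_root_bijective (X : TupledRing.{u} p) :
    Function.Bijective (expand (p := p) X.rootC X.rootGen) := by
  refine ⟨expand_injective_of_zero _ _ fun c hc => ?_, fun a => ?_⟩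
  · have h : Ideal.Quotient.mk X.rootIdeal (expand MvPolynomial.C MvPolynomial.X c) = 0 := by
      rw [map_expand _ _ X.rootC _ id (fun _ => rfl)]
      exact hc
    rw [← X.rootCoord_expand c]
    exact X.rootCoord_eq_zero (Ideal.Quotient.eq_zero_iff_mem.1 h)
  · obtain ⟨q, rfl⟩ := Ideal.Quotient.mk_surjective a
    exact ⟨_, X.expand_rootCoord q⟩

theorem rootPhi_rootC (X : TupledRing.{u} p) (r : X.carrier) : X.rootPhi (X.rootC r) = r ^ p :=
  X.rootPhi_C r

theorem rootC_rootPhi (X : TupledRing.{u} p) (a : X.RootRing) : X.rootC (X.rootPhi a) = a ^ p := by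
  have h : X.rootC.comp X.rootPhi = frobenius X.RootRing p := by
    apply rootRing_hom_ext
    · intro r
      exact (congrArg X.rootC (X.rootPhi_C r)).trans (map_pow _ _ _)
    · intro i
      exact (congrArg X.rootC (X.rootPhi_gen i)).trans (X.rootGen_pow i).symm
  exact RingHom.congr_fun h a

/-- `φ` in terms of coordinates. -/
theorem rootPhi_expand (X : TupledRing.{u} p) (c : (Fin X.len → Fin p) → X.carrier) :
    X.rootPhi (expand X.rootC X.rootGen c) = expand (frobenius X.carrier p) X.gen c := by
  rw [map_expand _ _ (frobenius X.carrier p) _ id fun r => X.rootPhi_rootC r]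
  congr 1
  funext i
  exact X.rootPhi_gen i

/-- The map `φ` of `(R'; x')` is `φ` of `(R; x)` on coordinates. -/
theorem rootPhi_root_expand (X : TupledRing.{u} p) (c : (Fin X.len → Fin p) → X.RootRing) :
    X.root.rootPhi (expand X.root.rootC X.root.rootGen c) =
      expand X.rootC X.rootGen (fun b => X.rootPhi (c b)) := by
  refine (X.root.rootPhi_expand c).trans ?_
  simp only [expand, rootC_rootPhi]
  rfl

theorem rootPhi_root_surjective (X : TupledRing.{u} p) (h : Function.Surjective X.rootPhi) :
    Function.Surjective X.root.rootPhi := by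
  intro a
  obtain ⟨c, rfl⟩ := X.expand_root_bijective.2 a
  choose d hd using fun b => h (c b)
  refine ⟨expand X.root.rootC X.root.rootGen d, ?_⟩
  rw [rootPhi_root_expand]
  exact congrArg _ (funext hd)

theorem rootPhi_root_eq_zero (X : TupledRing.{u} p) {c : (Fin X.len → Fin p) → X.RootRing}
    (h : X.root.rootPhi (expand X.root.rootC X.root.rootGen c) = 0) (b : Fin X.len → Fin p) :
    X.rootPhi (c b) = 0 := by
  rw [rootPhi_root_expand] at h
  exact congrFun (X.expand_root_bijective.1 (a₂ := 0) (h.trans (by simp [expand]))) b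

theorem rootPhi_root_injective (X : TupledRing.{u} p) (h : Function.Injective X.rootPhi) :
    Function.Injective X.root.rootPhi := by
  rw [injective_iff_map_eq_zero] at h ⊢
  intro a ha
  obtain ⟨c, rfl⟩ := X.root.expand_root_bijective.2 a
  have : c = 0 := funext fun b => h _ (X.rootPhi_root_eq_zero ha b)
  simp [this, expand]

theorem rootPhi_surjective (X : TupledRing.{u} p) (h : X.IsPGenerating) :
    Function.Surjective X.rootPhi := by
  intro a
  have ha : a ∈ Algebra.adjoin X.powSubring (Set.range X.gen) := by
    rw [h]; trivial
  refine Algebra.adjoin_induction (p := fun a _ => ∃ b, X.rootPhi b = a) ?_ ?_ ?_ ?_ ha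
  · rintro _ ⟨i, rfl⟩
    exact ⟨_, X.rootPhi_gen i⟩
  · rintro ⟨_, r, rfl⟩
    exact ⟨_, X.rootPhi_rootC r⟩
  · rintro _ _ _ _ ⟨a, rfl⟩ ⟨b, rfl⟩
    exact ⟨a + b, map_add _ _ _⟩
  · rintro _ _ _ _ ⟨a, rfl⟩ ⟨b, rfl⟩
    exact ⟨a * b, map_mul _ _ _⟩

/-- Independence over `R^p` only shows that the `p`-th powers of the coordinates vanish; reducedness
removes the power. -/
theorem rootPhi_injective (X : TupledRing.{u} p) [IsReduced X.carrier] (h : X.IsPIndependent) :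
    Function.Injective X.rootPhi := by
  rw [injective_iff_map_eq_zero]
  intro a ha
  obtain ⟨c, rfl⟩ := X.expand_root_bijective.2 a
  rw [rootPhi_expand] at ha
  have h0 := Fintype.linearIndependent_iff.1 h
    (fun b => ⟨frobenius X.carrier p (c b), c b, rfl⟩) ha
  have : c = 0 := by
    funext b
    exact pow_eq_zero_iff (Fact.out : p.Prime).ne_zero |>.1 (congrArg Subtype.val (h0 b))
  simp [this, expand]

end RootBasis

end TupledRing

namespace TupledRing

variable {p : ℕ}

/-- Serves to index the tuples of all the `R_i` by the indices of `x`. -/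
theorem expand_reindex {A B : Type*} [CommRing A] [CommRing B] {n m : ℕ} (f : A →+* B)
    (x : Fin m → B) (e : Fin n ≃ Fin m) (c : (Fin n → Fin p) → A) :
    expand f (x ∘ e) c = expand f x (fun b => c (b ∘ e)) := by
  refine Fintype.sum_equiv (e.arrowCongr (Equiv.refl _)) _ _ fun b => ?_
  have h1 : (e.arrowCongr (Equiv.refl (Fin p))) b ∘ e = b := by
    funext i
    simp
  have h2 : restrictedMonomial (x ∘ e) b =
      restrictedMonomial x ((e.arrowCongr (Equiv.refl (Fin p))) b) :=
    Fintype.prod_equiv e _ _ fun i => by simp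
  rw [h2]
  exact congrArg (fun b => f (c b) * _) h1.symm

theorem expand_reindex_bijective {A B : Type*} [CommRing A] [CommRing B] {n m : ℕ} {f : A →+* B}
    {x : Fin m → B} (e : Fin n ≃ Fin m) (h : Function.Bijective (expand (p := p) f x)) :
    Function.Bijective (expand (p := p) f (x ∘ e)) := by
  have he : expand (p := p) f (x ∘ e) =
      expand f x ∘ ((e.arrowCongr (Equiv.refl (Fin p))).symm.arrowCongr (Equiv.refl A)).symm := by
    funext c
    rw [expand_reindex]
    rfl
  rw [he]
  exact h.comp (Equiv.bijective _)

theorem finite_of_expand {A B : Type*} [CommRing A] [CommRing B] {n : ℕ} {f : A →+* B}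
    {x : Fin n → B} (h : Function.Surjective (expand (p := p) f x)) : f.Finite := by
  let _ := f.toAlgebra
  refine Module.Finite.of_surjective
    (Fintype.linearCombination A (restrictedMonomial (p := p) x)) fun a => ?_
  obtain ⟨c, rfl⟩ := h a
  refine ⟨c, ?_⟩
  simp only [Fintype.linearCombination_apply, Algebra.smul_def]
  rfl

variable [Fact p.Prime]

/-! ### The tower of the rings `R_i` -/

section Stages

variable (X : TupledRing.{u} p)

theorem stageIdx_bijective (i : ℕ) : Function.Bijective (X.stageIdx i) := by
  induction i with
  | zero => exact Function.bijective_id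
  | succ i ih => exact ih

/-- The tuple of `R_i`, with the indices of the tuple of `R`. -/
def stageGen (i : ℕ) (j : Fin X.len) : (X.stage i).carrier :=
  (X.stage i).gen (X.stageIdx i j)

/-- The coefficient map `R_i → R_{i+1}`. -/
def stageC (i : ℕ) : (X.stage i).carrier →+* (X.stage (i + 1)).carrier :=
  (X.stage i).rootC

theorem transition_stageC (i : ℕ) (a : (X.stage i).carrier) :
    (X.transition i).ringHom (X.stageC i a) = a ^ p :=
  (X.stage i).rootPhi_rootC a

theorem stageC_transition (i : ℕ) (a : (X.stage (i + 1)).carrier) :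
    X.stageC i ((X.transition i).ringHom a) = a ^ p :=
  (X.stage i).rootC_rootPhi a

theorem transition_stageGen (i : ℕ) (j : Fin X.len) :
    (X.transition i).ringHom (X.stageGen (i + 1) j) = X.stageGen i j :=
  (X.transition i).map_gen (X.stageIdx (i + 1) j)

theorem stage_expand_bijective (i : ℕ) :
    Function.Bijective (expand (p := p) (X.stageC i) (X.stageGen (i + 1))) :=
  expand_reindex_bijective (Equiv.ofBijective _ (X.stageIdx_bijective i))
    (X.stage i).expand_root_bijective

theorem transition_expand (i : ℕ) (c : (Fin X.len → Fin p) → (X.stage (i + 1)).carrier) :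
    (X.transition (i + 1)).ringHom (expand (X.stageC (i + 1)) (X.stageGen (i + 2)) c) =
      expand (X.stageC i) (X.stageGen (i + 1)) (fun b => (X.transition i).ringHom (c b)) := by
  rw [map_expand _ _ (X.stageC i) _ (X.transition i).ringHom]
  · exact congrArg (fun x => expand _ x _) (funext fun j => X.transition_stageGen (i + 1) j)
  · intro a
    rw [transition_stageC, stageC_transition]

theorem transition_surjective (h : Function.Surjective X.rootPhi) (i : ℕ) :
    Function.Surjective (X.transition i).ringHom := by
  induction i with
  | zero => exact h
  | succ i ih => exact (X.stage i).rootPhi_root_surjective ih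

theorem transition_injective (h : Function.Injective X.rootPhi) (i : ℕ) :
    Function.Injective (X.transition i).ringHom := by
  induction i with
  | zero => exact h
  | succ i ih => exact (X.stage i).rootPhi_root_injective ih

/-- Since `φ` acts coordinatewise, each kernel is generated by the image of the previous kernel
under the coefficient map. That map sends `f i k`, the image of `f (i + 1) k` under `φ`, to `f (i +
1) k ^ p`, so the exponent gains a factor `p` at each stage. -/
theorem ker_transition_le {ι : Type*} (f : ∀ i, ι → (X.stage (i + 1)).carrier)
    (hf : ∀ i k, (X.transition (i + 1)).ringHom (f (i + 1) k) = f i k)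
    (h : RingHom.ker (X.transition 0).ringHom ≤ Ideal.span (Set.range (f 0))) (i : ℕ) :
    RingHom.ker (X.transition i).ringHom ≤
      Ideal.span (Set.range fun k => f i k ^ p ^ i) := by
  induction i with
  | zero => simpa using h
  | succ i ih =>
    intro a ha
    obtain ⟨c, rfl⟩ := (X.stage_expand_bijective (i + 1)).2 a
    rw [RingHom.mem_ker, transition_expand] at ha
    have hc : ∀ b, (X.transition i).ringHom (c b) = 0 := fun b =>
      congrFun ((X.stage_expand_bijective i).1 (a₂ := 0) (ha.trans (by simp [expand]))) b
    refine Ideal.sum_mem _ fun b _ => Ideal.mul_mem_right _ _ ?_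
    have h1 := Ideal.mem_map_of_mem (X.stageC (i + 1)) (ih (RingHom.mem_ker.2 (hc b)))
    rw [Ideal.map_span, ← Set.range_comp] at h1
    convert h1 using 3
    funext k
    rw [Function.comp_apply, map_pow, ← hf i, stageC_transition, ← pow_mul, pow_succ' p]

end Stages

section Sequences

/-- In an inverse sequence of surjective maps, the projections from the limit are surjective. -/
theorem exists_compatible_of_surjective : ∀ (n : ℕ) {T : ℕ → Type u} (t : ∀ i, T (i + 1) → T i)
    (_ : ∀ i, Function.Surjective (t i)) (a : T n), ∃ s : ∀ i, T i, (∀ i, t i (s (i + 1)) = s i) ∧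
      s n = a
  | 0, T, t, ht, a => by
    choose g hg using ht
    exact ⟨fun i => Nat.rec a (fun i b => g i b) i, fun i => hg i _, rfl⟩
  | n + 1, T, t, ht, a => by
    obtain ⟨s, hs, hn⟩ := exists_compatible_of_surjective n (T := fun i => T (i + 1))
      (fun i => t (i + 1)) (fun i => ht (i + 1)) a
    refine ⟨fun i => Nat.rec (t 0 (s 0)) (fun i _ => s i) i, fun i => ?_, hn⟩
    cases i with
    | zero => rfl
    | succ i => exact hs i

end Sequences

/-! ### The limit is free over itself via Frobenius -/

section GabberBasis

variable (X : TupledRing.{u} p)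

theorem transition_gabberProj (i : ℕ) (a : X.gabberRing) :
    (X.transition i).ringHom (X.gabberProj (i + 1) a) = X.gabberProj i a :=
  a.2 i

theorem gabberProj_ext {a b : X.gabberRing} (h : ∀ i, X.gabberProj (i + 1) a =
    X.gabberProj (i + 1) b) : a = b := by
  refine Subtype.ext (funext fun i => ?_)
  cases i with
  | zero => exact (a.2 0).symm.trans ((congrArg _ (h 0)).trans (b.2 0))
  | succ i => exact h i

theorem gabberProj_surjective (h : Function.Surjective X.rootPhi) (i : ℕ) :
    Function.Surjective (X.gabberProj i) := by
  intro a
  obtain ⟨s, hs, hn⟩ := exists_compatible_of_surjective i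
    (T := fun i => (X.stage i).carrier)
    (fun i => (X.transition i).ringHom) (X.transition_surjective h) a
  exact ⟨⟨s, hs⟩, hn⟩

theorem gabberProj_zero_injective (h : Function.Injective X.rootPhi) :
    Function.Injective (X.gabberProj 0) := by
  intro a b hab
  refine Subtype.ext (funext fun i => ?_)
  induction i with
  | zero => exact hab
  | succ i ih =>
    apply X.transition_injective h i
    exact (a.2 i).trans (ih.trans (b.2 i).symm)

/-- On `G`, Frobenius followed by the projection to `R_{i+1}` is the projection to `R_i` followed by
the coefficient map; hence the shift of index. -/
theorem gabberProj_expand (c : (Fin X.len → Fin p) → X.gabberRing) (i : ℕ) :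
    X.gabberProj (i + 1) (expand (frobenius X.gabberRing p) X.gabberGen c) =
      expand (X.stageC i) (X.stageGen (i + 1)) (fun b => X.gabberProj i (c b)) := by
  rw [map_expand _ _ (X.stageC i) _ (X.gabberProj i)]
  · rfl
  · intro a
    rw [← X.transition_gabberProj i a, stageC_transition, frobenius_def, map_pow]

/-- The ring `G(R; x)` is free over itself via Frobenius, on the restricted monomials
in `x_∞`. -/
theorem gabber_expand_bijective :
    Function.Bijective (expand (p := p) (frobenius X.gabberRing p) X.gabberGen) := by
  refine ⟨expand_injective_of_zero _ _ fun c hc => funext fun b => ?_, fun a => ?_⟩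
  · refine Subtype.ext (funext fun i => ?_)
    have h := (X.gabberProj_expand c i).symm
    rw [hc, map_zero] at h
    exact congrFun ((X.stage_expand_bijective i).1 (a₂ := 0) (h.trans (by simp [expand]))) b
  -- The coordinates of the component in `R_{i+1}` lie in `R_i`; their uniqueness makes them
  -- compatible, so they define elements of the limit.
  · choose c hc using fun i => (X.stage_expand_bijective i).2 (X.gabberProj (i + 1) a)
    have hcompat : ∀ i b, (X.transition i).ringHom (c (i + 1) b) = c i b := by
      intro i b
      refine congrFun ((X.stage_expand_bijective i).1
        (a₁ := fun b => (X.transition i).ringHom (c (i + 1) b)) ?_) b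
      rw [← transition_expand, hc, hc, transition_gabberProj]
    refine ⟨fun b => ⟨fun i => c i b, fun i => hcompat i b⟩, X.gabberProj_ext fun i => ?_⟩
    rw [gabberProj_expand, ← hc]
    rfl

end GabberBasis

/-! ### From Frobenius expansions to `p`-bases -/

section PBasis

variable (X : TupledRing.{u} p)

theorem isPGenerating_of_expand
    (h : Function.Surjective (expand (p := p) (frobenius X.carrier p) X.gen)) :
    X.IsPGenerating := by
  refine eq_top_iff.2 fun a _ => ?_
  obtain ⟨c, rfl⟩ := h a
  refine Subalgebra.sum_mem _ fun b _ => Subalgebra.mul_mem _ ?_ ?_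
  · exact Subalgebra.algebraMap_mem (Algebra.adjoin X.powSubring (Set.range X.gen))
      (⟨frobenius X.carrier p (c b), c b, rfl⟩ : X.powSubring)
  · exact Subalgebra.prod_mem _ fun i _ =>
      Subalgebra.pow_mem _ (Algebra.subset_adjoin (Set.mem_range_self i)) _

theorem isPIndependent_of_expand
    (h : Function.Injective (expand (p := p) (frobenius X.carrier p) X.gen)) :
    X.IsPIndependent := by
  refine Fintype.linearIndependent_iff.2 fun g hg b => ?_
  choose c hc using fun b => (g b).2
  have h0 : expand (frobenius X.carrier p) X.gen c = 0 := by
    simp only [expand, hc]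
    exact hg
  have h1 : c = 0 := h (h0.trans (by simp [expand]))
  apply Subtype.ext
  rw [← hc b, h1]
  simp

end PBasis

end TupledRing

/-! ### Complete filtrations and Noetherianity -/

section CompleteFiltration

open Filter

/-- A ring is complete and separated with respect to a sequence of ideals. -/
structure IsCompleteFiltration {A : Type*} [CommRing A] (K : ℕ → Ideal A) : Prop where
  separated : ∀ a, (∀ m, a ∈ K m) → a = 0
  complete : ∀ s : ℕ → A, (∀ m, ∀ᶠ n in atTop, s (n + 1) - s n ∈ K m) →
    ∃ l, ∀ m, ∀ᶠ n in atTop, s n - l ∈ K m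

namespace IsCompleteFiltration

variable {A : Type*} [CommRing A] {K : ℕ → Ideal A}

/-- Successive approximation: if every element of `P n` is, modulo `P (n + 1)`, a combination of
the `j i` with coefficients in `V n`, and `P` and `V` tend to zero, then `P 0` is contained in the
ideal generated by the `j i`. -/
theorem mem_span_of_approx (hK : IsCompleteFiltration K) {ι : Type*} [Fintype ι] (j : ι → A)
    (P : ℕ → Set A) (V : ℕ → Ideal A) (hP : ∀ m, ∀ᶠ n in atTop, P n ⊆ K m)
    (hV : ∀ m, ∀ᶠ n in atTop, V n ≤ K m)
    (hstep : ∀ n, ∀ a ∈ P n, ∃ c : ι → A, (∀ i, c i ∈ V n) ∧ a - ∑ i, c i * j i ∈ P (n + 1))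
    {a : A} (ha : a ∈ P 0) : a ∈ Ideal.span (Set.range j) := by
  choose c hc hcP using hstep
  -- `r n` is the remainder after `n` approximations, and `s i n` is the partial sum of the
  -- coefficients of `j i`.
  let r : ∀ n, P n := fun n => Nat.rec ⟨a, ha⟩ (fun n b => ⟨_, hcP n b.1 b.2⟩) n
  let s : ι → ℕ → A := fun i n => ∑ k ∈ Finset.range n, c k (r k).1 (r k).2 i
  have hr : ∀ n, a - ∑ i, s i n * j i = (r n).1 := by
    intro n
    induction n with
    | zero => simp [s, r]
    | succ n ih =>
      have h1 : ∀ i, s i (n + 1) = s i n + c n (r n).1 (r n).2 i := fun i =>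
        Finset.sum_range_succ _ _
      simp only [h1, add_mul, Finset.sum_add_distrib, ← sub_sub, ih]
      rfl
  have hs : ∀ i, ∃ l, ∀ m, ∀ᶠ n in atTop, s i n - l ∈ K m := by
    refine fun i => hK.complete _ fun m => ?_
    filter_upwards [hV m] with n hn
    rw [show s i (n + 1) = s i n + c n (r n).1 (r n).2 i from Finset.sum_range_succ _ _,
      add_sub_cancel_left]
    exact hn (hc n _ _ i)
  choose l hl using hs
  have h0 : a - ∑ i, l i * j i = 0 := by
    refine hK.separated _ fun m => ?_
    obtain ⟨n, hn, hn'⟩ := ((eventually_all.2 fun i => hl i m).and (hP m)).exists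
    have h1 : a - ∑ i, l i * j i = (r n).1 + ∑ i, (s i n - l i) * j i := by
      rw [← hr n]
      simp only [sub_mul, Finset.sum_sub_distrib]
      ring
    rw [h1]
    exact (K m).add_mem (hn' (r n).2) (Ideal.sum_mem _ fun i _ => Ideal.mul_mem_right _ _ (hn i))
  rw [sub_eq_zero.1 h0]
  exact Ideal.sum_mem _ fun i _ => Ideal.mul_mem_left _ _ (Ideal.subset_span ⟨i, rfl⟩)

-- Take the degree `n` part of the relation: `h i` is replaced by its component of degree `n - d i`,
-- and by zero when `d i > n`, where the truncated difference would give a wrong degree.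
attribute [local instance] MvPolynomial.gradedAlgebra in
theorem exists_homogeneous_coeff {σ ι : Type*} [Fintype ι] {g : MvPolynomial σ A} {n : ℕ}
    (hg : g.IsHomogeneous n) {q h : ι → MvPolynomial σ A} {d : ι → ℕ}
    (hq : ∀ i, (q i).IsHomogeneous (d i)) (hgh : g = ∑ i, h i * q i) :
    ∃ h' : ι → MvPolynomial σ A, g = ∑ i, h' i * q i ∧
      ∀ i, h' i = 0 ∨ d i ≤ n ∧ (h' i).IsHomogeneous (n - d i) := by
  classical
  let 𝒜 := MvPolynomial.homogeneousSubmodule σ A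
  refine ⟨fun i => if d i ≤ n then (DirectSum.decompose 𝒜 (h i) (n - d i) : MvPolynomial σ A)
    else 0, ?_, fun i => ?_⟩
  · have h1 : g = (DirectSum.decompose 𝒜 g n : MvPolynomial σ A) :=
      (DirectSum.decompose_of_mem_same 𝒜 hg).symm
    rw [h1, hgh, DirectSum.decompose_sum, DFinsupp.finsetSum_apply, Submodule.coe_sum]
    refine Finset.sum_congr rfl fun i _ => ?_
    by_cases hi : d i ≤ n <;> simp only [hi, if_true, if_false]
    · exact DirectSum.coe_decompose_mul_of_right_mem_of_le 𝒜 (hq i) hi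
    · rw [zero_mul]
      exact DirectSum.coe_decompose_mul_of_right_mem_of_not_le 𝒜 (hq i) hi
  · by_cases hi : d i ≤ n
    · right
      simp only [hi, if_true]
      exact ⟨trivial, (DirectSum.decompose 𝒜 (h i) (n - d i)).2⟩
    · left
      simp [hi]

/-- A ring which is complete along a finitely generated ideal with Noetherian quotient is
Noetherian. -/
theorem isNoetherianRing (hK : IsCompleteFiltration K) {σ : Type*} [Finite σ] (x : σ → A)
    {I : Ideal A} (hI : I = Ideal.span (Set.range x)) (hIK : ∀ m, ∀ᶠ n in atTop, I ^ n ≤ K m)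
    [IsNoetherianRing (A ⧸ I)] : IsNoetherianRing A := by
  classical
  refine (isNoetherianRing_iff_ideal_fg A).2 fun J => ?_
  -- Forms that represent leading terms of elements of `J`. Their span contains the extension of
  -- `I`, so it is finitely generated as soon as its image over the Noetherian ring `A ⧸ I` is;
  -- Noetherianity of `A` is not needed.
  let S : Set (MvPolynomial σ A) :=
    {g | ∃ n, g.IsHomogeneous n ∧ MvPolynomial.eval x g ∈ J ⊔ I ^ (n + 1)}
  have hker : RingHom.ker (MvPolynomial.map (σ := σ) (Ideal.Quotient.mk I)) =
      I.map MvPolynomial.C := by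
    rw [MvPolynomial.ker_map, Ideal.mk_ker]
  have hle : I.map MvPolynomial.C ≤ Ideal.span S := by
    refine Ideal.map_le_iff_le_comap.2 fun a ha => Ideal.subset_span ?_
    refine ⟨0, MvPolynomial.isHomogeneous_C _ _, Ideal.mem_sup_right ?_⟩
    simpa using ha
  have hIfg : I.FG := hI ▸ Submodule.fg_span (Set.finite_range x)
  have hfg : (Ideal.span S).FG := by
    refine Ideal.fg_of_fg_map_of_fg_inf_ker_of_surjective
      (f := MvPolynomial.map (σ := σ) (Ideal.Quotient.mk I)) ?_ ?_
      (MvPolynomial.map_surjective _ Ideal.Quotient.mk_surjective)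
    · exact (isNoetherianRing_iff_ideal_fg _).1 inferInstance _
    · rw [hker, inf_eq_right.2 hle]
      exact hIfg.map _
  obtain ⟨T, hTS, hT⟩ := (Submodule.fg_span_iff_fg_span_finset_subset S).1 hfg
  choose d hd hdJ using fun g : T => hTS g.2
  choose j hj hjd using fun g : T => Submodule.mem_sup.1 (hdJ g)
  refine ⟨Finset.univ.image j, le_antisymm (Submodule.span_le.2 ?_) fun a ha => ?_⟩
  · intro a ha
    simp only [Finset.coe_image, Finset.coe_univ, Set.image_univ] at ha
    obtain ⟨g, rfl⟩ := ha
    exact hj g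
  rw [Finset.coe_image, Finset.coe_univ, Set.image_univ]
  -- Generators of degree `d` reach an element of `I ^ n` with coefficients of degree `n - d`; the
  -- supremum of the finitely many degrees gives a uniform bound that still tends to infinity.
  refine hK.mem_span_of_approx j (fun n => (J ⊓ I ^ n : Ideal A))
    (fun n => I ^ (n - Finset.univ.sup d)) ?_ ?_ ?_ (a := a) ?_
  · intro m
    filter_upwards [hIK m] with n hn
    exact inf_le_right.trans hn
  · intro m
    exact (tendsto_sub_atTop_nat _).eventually (hIK m)
  · rintro n a ⟨haJ, haI⟩
    obtain ⟨g, hg, rfl⟩ := (Ideal.mem_span_pow_iff_exists_isHomogeneous x a).1 (hI ▸ haI)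
    have hgS : g ∈ Submodule.span (MvPolynomial σ A) (T : Set (MvPolynomial σ A)) :=
      hT ▸ Ideal.subset_span ⟨n, hg, Ideal.mem_sup_left haJ⟩
    obtain ⟨h, hh⟩ := Submodule.mem_span_finset'.1 hgS
    obtain ⟨h', hgh, hh'⟩ := exists_homogeneous_coeff hg hd hh.symm
    have heval : ∀ (q : MvPolynomial σ A) (k : ℕ), q.IsHomogeneous k →
        MvPolynomial.eval x q ∈ I ^ k := fun q k hq => by
      rw [hI]
      exact (Ideal.mem_span_pow_iff_exists_isHomogeneous x _).2 ⟨q, hq, rfl⟩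
    refine ⟨fun g => MvPolynomial.eval x (h' g), fun i => ?_, ?_, ?_⟩
    · rcases hh' i with h0 | ⟨hi, h0⟩
      · simp [h0]
      · exact Ideal.pow_le_pow_right
          (Nat.sub_le_sub_left (Finset.le_sup (Finset.mem_univ i)) n) (heval _ _ h0)
    · exact J.sub_mem haJ (Ideal.sum_mem _ fun i _ => J.mul_mem_left _ (hj i))
    · have h1 : MvPolynomial.eval x g - ∑ i, MvPolynomial.eval x (h' i) * j i =
          ∑ i, MvPolynomial.eval x (h' i) * (MvPolynomial.eval x i.1 - j i) := by
        conv_lhs => rw [hgh]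
        simp [mul_sub, Finset.sum_sub_distrib]
      rw [h1]
      refine Ideal.sum_mem _ fun i _ => ?_
      obtain ⟨e, he, hje⟩ := hjd i
      rw [← hje, add_sub_cancel_left]
      rcases hh' i with h0 | ⟨hi, h0⟩
      · simp [h0]
      · have := Ideal.mul_mem_mul (heval _ _ h0) he
        rwa [← pow_add, show n - d i + (d i + 1) = n + 1 by omega] at this
  · simpa using ha

end IsCompleteFiltration

end CompleteFiltration

/-! ### The limit is Noetherian -/

namespace TupledRing

open Filter

variable {p : ℕ} [Fact p.Prime] (X : TupledRing.{u} p)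

/-- A Cauchy sequence becomes constant in each `R_m`, and these constants are compatible. -/
theorem isCompleteFiltration_gabber :
    IsCompleteFiltration fun m => RingHom.ker (X.gabberProj m) where
  separated a ha := Subtype.ext (funext fun m => ha m)
  complete s hs := by
    have h : ∀ m, ∃ l, ∀ᶠ n in atTop, X.gabberProj m (s n) = l := by
      intro m
      obtain ⟨N, hN⟩ := eventually_atTop.1 (hs m)
      refine ⟨X.gabberProj m (s N), eventually_atTop.2 ⟨N, fun n hn => ?_⟩⟩
      induction n, hn using Nat.le_induction with
      | base => rfl
      | succ n hn ih =>
        have h1 := RingHom.mem_ker.1 (hN n hn)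
        rw [map_sub, sub_eq_zero] at h1
        exact h1.trans ih
    choose l hl using h
    refine ⟨⟨l, fun m => ?_⟩, fun m => ?_⟩
    · obtain ⟨n, h1, h2⟩ := ((hl m).and (hl (m + 1))).exists
      rw [← h1, ← h2]
      exact X.transition_gabberProj m (s n)
    · filter_upwards [hl m] with n hn
      rw [RingHom.mem_ker, map_sub, hn]
      exact sub_self _

/-- The `p`-th power of a component comes from the previous stage through the coefficient map. Thus
`ker (G → R)` has nilpotent image in every `R_m`, and its powers tend to zero once it is finitely
generated. -/
theorem gabberProj_pow_eq_zero {a : X.gabberRing} (ha : X.gabberProj 0 a = 0) (m : ℕ) :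
    X.gabberProj m a ^ p ^ m = 0 := by
  induction m with
  | zero => simpa using ha
  | succ m ih =>
    rw [pow_succ', pow_mul, ← stageC_transition, transition_gabberProj, ← map_pow, ih, map_zero]

theorem isNoetherianRing_gabber [IsNoetherianRing X.carrier] (hX : Function.Surjective X.rootPhi) :
    IsNoetherianRing X.gabberRing := by
  have : IsNoetherianRing X.RootRing := inferInstance
  obtain ⟨T, hT⟩ := (isNoetherianRing_iff_ideal_fg X.RootRing).1 inferInstance
    (RingHom.ker X.rootPhi)
  choose x hx using fun t : T => X.gabberProj_surjective hX 1 t.1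
  have hx0 : ∀ t, X.gabberProj 0 (x t) = 0 := by
    intro t
    rw [← transition_gabberProj, hx]
    have h : t.1 ∈ RingHom.ker X.rootPhi := hT ▸ Ideal.subset_span t.2
    exact h
  have hker := X.ker_transition_le (fun i t => X.gabberProj (i + 1) (x t))
    (fun i t => X.transition_gabberProj (i + 1) (x t)) (by
      have h : Set.range (fun t => X.gabberProj 1 (x t)) = (T : Set X.RootRing) :=
        (congrArg Set.range (funext hx)).trans Subtype.range_coe
      exact hT.ge.trans (Ideal.span_mono h.ge))
  have hspan : ∀ m, ∀ᶠ n in atTop,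
      Ideal.span (Set.range x) ^ n ≤ RingHom.ker (X.gabberProj m) := by
    intro m
    obtain ⟨N, hN⟩ := Ideal.exists_pow_le_of_le_radical_of_fg
      (I := Ideal.span (Set.range x)) (J := RingHom.ker (X.gabberProj m)) (Ideal.span_le.2 (by
        rintro _ ⟨t, rfl⟩
        exact ⟨p ^ m, by rw [RingHom.mem_ker, map_pow, X.gabberProj_pow_eq_zero (hx0 t)]⟩))
      (Submodule.fg_span (Set.finite_range x))
    exact eventually_atTop.2 ⟨N, fun n hn => (Ideal.pow_le_pow_right hn).trans hN⟩
  have hI : RingHom.ker (X.gabberProj 0) = Ideal.span (Set.range x) := by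
    refine le_antisymm (fun a ha => ?_) (Ideal.span_le.2 (by rintro _ ⟨t, rfl⟩; exact hx0 t))
    refine X.isCompleteFiltration_gabber.mem_span_of_approx x
      (fun n => RingHom.ker (X.gabberProj n)) (fun n => Ideal.span (Set.range x) ^ n) ?_ hspan
      ?_ ha
    · intro m
      refine eventually_atTop.2 ⟨m, fun n hn => ?_⟩
      induction n, hn using Nat.le_induction with
      | base => exact subset_rfl
      | succ n hn ih =>
        refine subset_trans (fun a ha => ?_) ih
        have h : X.gabberProj (n + 1) a = 0 := ha
        show X.gabberProj n a = 0
        rw [← transition_gabberProj, h, map_zero]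
    · intro n a ha
      have ha' : X.gabberProj (n + 1) a ∈ RingHom.ker (X.transition n).ringHom := by
        rw [RingHom.mem_ker, transition_gabberProj]
        exact ha
      obtain ⟨c, hc⟩ := Ideal.mem_span_range_iff_exists_fun.1 (hker n ha')
      choose g hg using fun t => X.gabberProj_surjective hX (n + 1) (c t)
      -- One factor of `x t ^ p ^ n` plays the generator; the remaining `p ^ n - 1 ≥ n` factors put
      -- the coefficient in the `n`-th power.
      refine ⟨fun t => g t * x t ^ (p ^ n - 1), fun t => ?_, ?_⟩
      · refine Ideal.mul_mem_left _ _ (Ideal.pow_le_pow_right ?_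
          (Ideal.pow_mem_pow (Ideal.subset_span (Set.mem_range_self t)) _))
        exact Nat.le_sub_one_of_lt (Nat.lt_pow_self (Fact.out : p.Prime).one_lt)
      · show X.gabberProj (n + 1) _ = 0
        rw [map_sub, ← hc, map_sum, sub_eq_zero]
        refine Finset.sum_congr rfl fun t _ => ?_
        rw [mul_assoc, ← pow_succ, Nat.sub_add_cancel
          (Nat.one_le_pow _ _ (Fact.out : p.Prime).pos), map_mul, map_pow, hg]
  have hsurj : Function.Surjective (X.gabberProj 0) := X.gabberProj_surjective hX 0
  have : IsNoetherianRing (X.gabberRing ⧸ RingHom.ker (X.gabberProj 0)) :=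
    isNoetherianRing_of_ringEquiv X.carrier
      (RingHom.quotientKerEquivOfSurjective hsurj).symm
  exact X.isCompleteFiltration_gabber.isNoetherianRing x hI (hI ▸ hspan)

end TupledRing

/-! ### Counting generators modulo ideals along iterates of Frobenius -/

section SpansModulo

variable {A : Type*} [CommRing A]

/-- There are `n` elements such that every element of `I` is, modulo `J`, a combination of them
with coefficients in the image of `f`. -/
def SpansModulo (f : A →+* A) (I J : Ideal A) (n : ℕ) : Prop :=
  ∃ z : Fin n → A, ∀ a ∈ I, ∃ c : Fin n → A, a - ∑ j, f (c j) * z j ∈ J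

namespace SpansModulo

variable {f g : A →+* A} {I J L : Ideal A} {n m : ℕ}

theorem of_fintype {κ : Type*} [Fintype κ] (z : κ → A)
    (h : ∀ a ∈ I, ∃ c : κ → A, a - ∑ j, f (c j) * z j ∈ J) :
    SpansModulo f I J (Fintype.card κ) := by
  let e := (Fintype.equivFin κ).symm
  refine ⟨z ∘ e, fun a ha => ?_⟩
  obtain ⟨c, hc⟩ := h a ha
  refine ⟨c ∘ e, ?_⟩
  rwa [Fintype.sum_equiv e (fun j => f ((c ∘ e) j) * (z ∘ e) j) (fun j => f (c j) * z j)
    fun _ => rfl]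

theorem mono_right (h : SpansModulo f I J n) (hJL : J ≤ L) : SpansModulo f I L n :=
  h.imp fun _ hz a ha => (hz a ha).imp fun _ hc => hJL hc

theorem trans (h : SpansModulo f I J n) (h' : SpansModulo f J L m) :
    SpansModulo f I L (n + m) := by
  obtain ⟨z, hz⟩ := h
  obtain ⟨w, hw⟩ := h'
  refine ⟨Fin.append z w, fun a ha => ?_⟩
  obtain ⟨c, hc⟩ := hz a ha
  obtain ⟨d, hd⟩ := hw _ hc
  refine ⟨Fin.append c d, ?_⟩
  simpa [Fin.sum_univ_add, sub_sub] using hd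

theorem comp (hf : SpansModulo f ⊤ I n) (hg : SpansModulo g ⊤ I m) (hI : I ≤ I.comap g) :
    SpansModulo (g.comp f) ⊤ I (m * n) := by
  obtain ⟨z, hz⟩ := hf
  obtain ⟨w, hw⟩ := hg
  have h := of_fintype (f := g.comp f) (I := ⊤) (J := I)
    (fun j : Fin m × Fin n => g (z j.2) * w j.1) fun a ha => by
      obtain ⟨c, hc⟩ := hw a trivial
      choose d hd using fun j => hz (c j) trivial
      refine ⟨fun j => d j.1 j.2, ?_⟩
      have h1 : a - ∑ j : Fin m × Fin n, (g.comp f) (d j.1 j.2) * (g (z j.2) * w j.1) =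
          (a - ∑ j, g (c j) * w j) + ∑ j, g (c j - ∑ l, f (d j l) * z l) * w j := by
        simp [Fintype.sum_prod_type, sub_mul, Finset.sum_sub_distrib, Finset.sum_mul, mul_assoc]
      rw [h1]
      exact I.add_mem hc (I.sum_mem fun j _ => I.mul_mem_right _ (hI (hd j)))
  simpa using h

theorem iterate (hf : SpansModulo f ⊤ I n) (hI : I ≤ I.comap f) (e : ℕ) :
    SpansModulo (f ^ e) ⊤ I (n ^ e) := by
  induction e with
  | zero =>
    rw [pow_zero, pow_zero]
    exact ⟨fun _ => 1, fun a _ => ⟨fun _ => a, by simp⟩⟩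
  | succ e ih =>
    rw [pow_succ' f, pow_succ' n]
    exact ih.comp hf hI

theorem mul_span (hf : SpansModulo f ⊤ I n) {ι : Type*} [Fintype ι] (b : ι → A) :
    SpansModulo f (Ideal.span (Set.range b)) (I * Ideal.span (Set.range b))
      (Fintype.card ι * n) := by
  obtain ⟨z, hz⟩ := hf
  have h := of_fintype (f := f) (I := Ideal.span (Set.range b))
    (J := I * Ideal.span (Set.range b)) (fun j : ι × Fin n => z j.2 * b j.1) fun a ha => by
      obtain ⟨c, rfl⟩ := Ideal.mem_span_range_iff_exists_fun.1 ha
      choose d hd using fun i => hz (c i) trivial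
      refine ⟨fun j => d j.1 j.2, ?_⟩
      have h1 : ∑ i, c i * b i - ∑ j : ι × Fin n, f (d j.1 j.2) * (z j.2 * b j.1) =
          ∑ i, (c i - ∑ l, f (d i l) * z l) * b i := by
        simp [Fintype.sum_prod_type, sub_mul, Finset.sum_sub_distrib, Finset.sum_mul, mul_assoc]
      rw [h1]
      exact Ideal.sum_mem _ fun i _ => Ideal.mul_mem_mul (hd i)
        (Ideal.subset_span (Set.mem_range_self i))
  simpa using h

/-- Filter by the powers of `I`: the layer `I ^ j / I ^ (j + 1)` costs `n` times the number of
generators of `I ^ j`. What matters is that `C` does not depend on `f`, so it serves all iterates of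
Frobenius. -/
theorem exists_pow [IsNoetherianRing A] (I : Ideal A) (t : ℕ) :
    ∃ C, ∀ (f : A →+* A) (n : ℕ), SpansModulo f ⊤ I n → SpansModulo f ⊤ (I ^ t) (C * n) := by
  induction t with
  | zero =>
    refine ⟨0, fun f n _ => ?_⟩
    rw [zero_mul]
    exact ⟨fun _ => 0, fun a _ => ⟨fun _ => 0, by simp⟩⟩
  | succ t ih =>
    obtain ⟨C, hC⟩ := ih
    obtain ⟨T, hT⟩ := (isNoetherianRing_iff_ideal_fg A).1 inferInstance (I ^ t)
    refine ⟨C + Fintype.card T, fun f n h => ?_⟩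
    have h1 := h.mul_span (fun t : T => t.1)
    rw [show Set.range (fun t : T => t.1) = (T : Set A) from Subtype.range_coe,
      show Ideal.span (T : Set A) = I ^ t from hT, ← pow_succ'] at h1
    rw [add_mul]
    exact (hC f n h).trans h1

/-- Modulo `I`, the quotient by `y ^ q` has `q` layers, each a quotient of the one by `y`. -/
theorem sup_span_pow {y : A} (h : SpansModulo f ⊤ (I ⊔ Ideal.span {y}) n) (q : ℕ) :
    SpansModulo f ⊤ (I ⊔ Ideal.span {y ^ q}) (q * n) := by
  induction q with
  | zero =>
    rw [zero_mul]
    exact ⟨fun _ => 0, fun a _ => ⟨fun _ => 0, by simp⟩⟩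
  | succ q ih =>
    obtain ⟨w, hw⟩ := h
    obtain ⟨z, hz⟩ := ih
    rw [add_mul, one_mul]
    refine ⟨Fin.append (fun j => y * z j) w, fun a _ => ?_⟩
    obtain ⟨d, hd⟩ := hw a trivial
    obtain ⟨i, hi, r, hr, hir⟩ := Submodule.mem_sup.1 hd
    obtain ⟨a', rfl⟩ := Ideal.mem_span_singleton'.1 hr
    obtain ⟨c, hc⟩ := hz a' trivial
    obtain ⟨i', hi', r', hr', hir'⟩ := Submodule.mem_sup.1 hc
    obtain ⟨a'', rfl⟩ := Ideal.mem_span_singleton'.1 hr'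
    refine ⟨Fin.append c d, ?_⟩
    have h1 : a - ∑ j, f (Fin.append c d j) * Fin.append (fun j => y * z j) w j =
        (i + y * i') + a'' * y ^ (q + 1) := by
      have h2 : ∑ j, f (c j) * (y * z j) = y * ∑ j, f (c j) * z j := by
        rw [Finset.mul_sum]
        exact Finset.sum_congr rfl fun _ _ => by ring
      simp only [Fin.sum_univ_add, Fin.append_left, Fin.append_right, h2]
      linear_combination (-1 : A) * hir - y * hir'
    rw [h1]
    exact Submodule.add_mem_sup (I.add_mem hi (I.mul_mem_left _ hi'))
      (Ideal.mul_mem_left _ _ (Ideal.mem_span_singleton_self _))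

theorem sup_span_pow_finset (q : ℕ) (T : Finset A) :
    ∀ {I : Ideal A} {n : ℕ}, SpansModulo f ⊤ (I ⊔ Ideal.span (T : Set A)) n →
      SpansModulo f ⊤ (I ⊔ Ideal.span ((fun y => y ^ q) '' (T : Set A))) (q ^ T.card * n) := by
  classical
  induction T using Finset.induction_on with
  | empty =>
    intro I n h
    simpa using h
  | insert y T hy ih =>
    intro I n h
    rw [Finset.coe_insert, Ideal.span_insert, sup_comm (Ideal.span {y}), ← sup_assoc] at h
    have h1 := h.sup_span_pow q
    rw [sup_assoc, sup_comm (Ideal.span (T : Set A)), ← sup_assoc] at h1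
    rw [Finset.coe_insert, Set.image_insert_eq, Ideal.span_insert, ← sup_assoc,
      Finset.card_insert_of_notMem hy, pow_succ, mul_assoc]
    exact ih h1

end SpansModulo

/-- The ring `B` is free on the family `y` as a module over `A` via `f`. -/
def RingHom.IsFreeOn {A B : Type*} [CommRing A] [CommRing B] (f : A →+* B) {ι : Type*} [Fintype ι]
    (y : ι → B) : Prop :=
  Function.Bijective fun c : ι → A => ∑ i, f (c i) * y i

namespace RingHom.IsFreeOn

theorem comp {f g : A →+* A} {ι κ : Type*} [Fintype ι] [Fintype κ] {y : ι → A} {z : κ → A}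
    (hf : f.IsFreeOn y) (hg : g.IsFreeOn z) :
    (g.comp f).IsFreeOn fun j : κ × ι => g (y j.2) * z j.1 := by
  have h : (fun c : κ × ι → A => ∑ j, (g.comp f) (c j) * (g (y j.2) * z j.1)) =
      (fun c : κ → A => ∑ j, g (c j) * z j) ∘
        (fun (c : κ → ι → A) j => ∑ i, f (c j i) * y i) ∘ Function.curry := by
    funext c
    simp [Fintype.sum_prod_type, Finset.sum_mul, mul_assoc]
  have h1 : Function.Bijective (fun (c : κ → ι → A) j => ∑ i, f (c j i) * y i) :=
    Function.Bijective.piMap fun _ => hf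
  rw [RingHom.IsFreeOn, h]
  exact Function.Bijective.comp hg (h1.comp (Equiv.curry κ ι A).bijective)

theorem exists_iterate {f : A →+* A} {ι : Type} [Fintype ι] {y : ι → A} (hf : f.IsFreeOn y)
    (e : ℕ) : ∃ (κ : Type) (_ : Fintype κ) (z : κ → A),
      Fintype.card κ = Fintype.card ι ^ e ∧ (f ^ e).IsFreeOn z := by
  induction e with
  | zero =>
    refine ⟨Unit, inferInstance, fun _ => 1, by simp, ?_⟩
    exact ⟨fun c d h => funext fun i => by simpa using h, fun a => ⟨fun _ => a, by simp⟩⟩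
  | succ e ih =>
    obtain ⟨κ, _, z, hκ, hz⟩ := ih
    refine ⟨ι × κ, inferInstance, fun j => f (z j.2) * y j.1, ?_, ?_⟩
    · rw [Fintype.card_prod, hκ, pow_succ']
    · rw [pow_succ' f]
      exact hz.comp hf

/-- The rank of a free extension is at most the number of elements which generate it modulo the
extension of a maximal ideal. -/
theorem card_le [IsLocalRing A] {f : A →+* A} {ι : Type*} [Fintype ι] {y : ι → A}
    (hf : f.IsFreeOn y) {n : ℕ}
    (h : SpansModulo f ⊤ ((IsLocalRing.maximalIdeal A).map f) n) : Fintype.card ι ≤ n := by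
  classical
  obtain ⟨z, hz⟩ := h
  choose c hc using fun i => hz (y i) trivial
  choose d hd using fun j => hf.2 (z j)
  -- Elements of the extended ideal have coordinates in the maximal ideal.
  have hmap : ∀ a ∈ (IsLocalRing.maximalIdeal A).map f, ∃ b : ι → A,
      (∀ i, b i ∈ IsLocalRing.maximalIdeal A) ∧ a = ∑ i, f (b i) * y i := by
    intro a ha
    refine Submodule.span_induction (p := fun a _ => ∃ b : ι → A,
      (∀ i, b i ∈ IsLocalRing.maximalIdeal A) ∧ a = ∑ i, f (b i) * y i) ?_ ?_ ?_ ?_ ha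
    · rintro _ ⟨r, hr, rfl⟩
      obtain ⟨b, hb⟩ := hf.2 1
      refine ⟨fun i => r * b i, fun i => Ideal.mul_mem_right _ _ hr, ?_⟩
      simp only at hb
      rw [← mul_one (f r), ← hb, Finset.mul_sum]
      simp [mul_assoc]
    · exact ⟨0, by simp, by simp⟩
    · rintro _ _ _ _ ⟨b, hb, rfl⟩ ⟨b', hb', rfl⟩
      exact ⟨b + b', fun i => Ideal.add_mem _ (hb i) (hb' i), by
        simp [add_mul, Finset.sum_add_distrib]⟩
    · rintro r _ _ ⟨b, hb, rfl⟩
      choose s hs using fun i => hf.2 (r * y i)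
      refine ⟨fun i => ∑ k, b k * s k i,
        fun i => Ideal.sum_mem _ fun k _ => Ideal.mul_mem_right _ _ (hb k), ?_⟩
      simp only [map_sum, map_mul, Finset.sum_mul, smul_eq_mul, Finset.mul_sum]
      rw [Finset.sum_comm]
      refine Finset.sum_congr rfl fun k _ => ?_
      rw [mul_left_comm, ← hs k, Finset.mul_sum]
      exact Finset.sum_congr rfl fun _ _ => by ring
  choose b hb hyb using fun i => hmap _ (hc i)
  -- Expressing `y` through `z` and back is the identity modulo the maximal ideal, so over the
  -- residue field an identity matrix factors through dimension `n`.
  have key : ∀ i k, (if i = k then 1 else 0) - ∑ j, c i j * d j k = b i k := by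
    intro i k
    refine congrFun (hf.1 (a₁ := fun k => (if i = k then 1 else 0) - ∑ j, c i j * d j k) ?_) k
    simp only [map_sub, map_sum, map_mul, sub_mul, Finset.sum_sub_distrib, Finset.sum_mul]
    rw [← hyb i]
    congr 1
    · rw [Finset.sum_eq_single i]
      · simp
      · intro k _ hk
        simp [hk.symm]
      · simp
    · rw [Finset.sum_comm]
      refine Finset.sum_congr rfl fun j _ => ?_
      rw [← hd j, Finset.mul_sum]
      exact Finset.sum_congr rfl fun _ _ => by ring
  let π := IsLocalRing.residue A
  let M : Matrix ι (Fin n) (IsLocalRing.ResidueField A) := fun i j => π (c i j)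
  let M' : Matrix (Fin n) ι (IsLocalRing.ResidueField A) := fun j i => π (d j i)
  have hM : M * M' = 1 := by
    ext i k
    have h1 := (IsLocalRing.residue_eq_zero_iff _).2 (hb i k)
    rw [← key, map_sub, sub_eq_zero] at h1
    rw [Matrix.mul_apply, Matrix.one_apply]
    simpa [M, M', π] using h1.symm
  calc Fintype.card ι = (M * M').rank := by rw [hM, Matrix.rank_one]
    _ ≤ M.rank := Matrix.rank_mul_le_left _ _
    _ ≤ n := by simpa using M.rank_le_card_width

end RingHom.IsFreeOn

/-- If `a ≥ b + 1`, Bernoulli's inequality `(1 + 1/b)^e ≥ 1 + e/b` at `e = C * b` gives `1 + C ≤ C`.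
-/
theorem Nat.le_of_forall_pow_le_mul_pow {a b C : ℕ} (h : ∀ e, a ^ e ≤ C * b ^ e) : a ≤ b := by
  by_contra! hab
  rcases Nat.eq_zero_or_pos b with rfl | hb
  · have := h 1
    simp at this
    omega
  have h1 : (b + 1) ^ (C * b) ≤ C * b ^ (C * b) := (Nat.pow_le_pow_left hab _).trans (h _)
  have h2 : ∀ e, b ^ e * (b + e) ≤ b * (b + 1) ^ e := by
    intro e
    induction e with
    | zero => simp
    | succ e ih =>
      have h3 := Nat.mul_le_mul_right (b + 1) ih
      have h4 : b ^ (e + 1) * (b + (e + 1)) ≤ b ^ e * (b + e) * (b + 1) := by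
        rw [pow_succ, mul_assoc, mul_assoc]
        refine Nat.mul_le_mul_left _ ?_
        nlinarith
      calc _ ≤ _ := h4
        _ ≤ _ := h3
        _ = _ := by rw [pow_succ, mul_assoc]
  have h3 := (h2 (C * b)).trans (Nat.mul_le_mul_left b h1)
  have h4 : 0 < b ^ (C * b) := Nat.pow_pos hb
  nlinarith

end SpansModulo

/-! ### Adjoining the `x_i` to the `p`-th powers of a local ring -/

section PthRoots

open IsLocalRing Polynomial

theorem exists_eval₂_of_pow_mem {A : Type*} [CommRing A] [Nontrivial A] {p : ℕ} [Fact p.Prime]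
    {C : Subring A} {x : A} (hx : x ^ p ∈ C) {a : A}
    (ha : a ∈ (eval₂RingHom C.subtype x).range) :
    ∃ P : C[X], P.degree < p ∧ P.eval₂ C.subtype x = a := by
  obtain ⟨Q, rfl⟩ := ha
  have : Nontrivial C := C.subtype.domain_nontrivial
  have hp : p.Prime := Fact.out
  have hmon : (X ^ p - Polynomial.C (⟨x ^ p, hx⟩ : C)).Monic := monic_X_pow_sub_C _ hp.ne_zero
  refine ⟨Q %ₘ (X ^ p - Polynomial.C ⟨x ^ p, hx⟩), ?_, ?_⟩
  · refine (degree_modByMonic_lt _ hmon).trans_eq ?_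
    exact degree_X_pow_sub_C hp.pos _
  · conv_rhs => rw [← modByMonic_add_div Q (X ^ p - Polynomial.C (⟨x ^ p, hx⟩ : C))]
    simp

variable {A : Type*} [CommRing A] [IsLocalRing A] {p : ℕ} [Fact p.Prime] [CharP A p]

instance IsLocalRing.ResidueField.charP : CharP (ResidueField A) p := by
  refine (CharP.charP_iff_prime_eq_zero Fact.out).2 ?_
  rw [← map_natCast (residue A), CharP.cast_eq_zero, map_zero]

/-- The image in the residue field of a subring which contains all `p`-th powers. -/
def residueSubfield (C : Subring A) (hC : (frobenius A p).range ≤ C) :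
    Subfield (ResidueField A) :=
  { C.map (residue A) with
    inv_mem' := by
      rintro _ ⟨c, hc, rfl⟩
      rcases eq_or_ne (residue A c) 0 with h | h
      · rw [h, inv_zero]
        exact (C.map (residue A)).zero_mem
      · obtain ⟨d, hd⟩ := residue_surjective (residue A c)⁻¹
        refine ⟨d ^ p * c ^ (p - 1), C.mul_mem (hC ⟨d, rfl⟩) (C.pow_mem hc _), ?_⟩
        have hp : p = p - 1 + 1 := (Nat.sub_add_cancel (Fact.out : p.Prime).pos).symm
        rw [map_mul, map_pow, map_pow, hd, hp, pow_succ', Nat.add_sub_cancel, mul_assoc,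
          ← mul_pow, inv_mul_cancel₀ h, one_pow, mul_one] }

/-- The residue of `x` lies outside the residue field `E` of `C`, and `p`-th roots in characteristic
`p` are unique, so its minimal polynomial over `E` has degree `p`. A relation of smaller degree is
therefore trivial over `E`. -/
theorem coeff_mem_maximalIdeal (C : Subring A) (hC : (frobenius A p).range ≤ C) {x : A}
    (hx : ∀ c ∈ C, x - c ∉ maximalIdeal A) {P : C[X]} (hP : P.degree < p)
    (hPx : P.eval₂ C.subtype x ∈ maximalIdeal A) (j : ℕ) :
    (P.coeff j : A) ∈ maximalIdeal A := by
  have hp : p.Prime := Fact.out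
  let E := residueSubfield C hC
  let φ : C →+* E := ((residue A).comp C.subtype).codRestrict E fun c => ⟨c.1, c.2, rfl⟩
  let a : E := φ ⟨x ^ p, hC ⟨x, rfl⟩⟩
  have ha : (a : ResidueField A) = residue A x ^ p := map_pow (residue A) x p
  have hirr : Irreducible (X ^ p - Polynomial.C a) := by
    refine X_pow_sub_C_irreducible_of_prime hp ?_
    rintro ⟨_, c, hc, rfl⟩ hb
    have h1 : residue A c ^ p = residue A x ^ p := (congrArg Subtype.val hb).trans ha
    have h2 : residue A c = residue A x := frobenius_inj (ResidueField A) p h1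
    refine hx c hc ((residue_eq_zero_iff _).1 ?_)
    rw [map_sub, h2, sub_self]
  have hmin : minpoly E (residue A x) = X ^ p - Polynomial.C a :=
    (minpoly.eq_of_irreducible_of_monic hirr (by
      rw [map_sub, map_pow, aeval_X, aeval_C]
      exact sub_eq_zero.2 ha.symm) (monic_X_pow_sub_C a hp.ne_zero)).symm
  have h0 : P.map φ = 0 := by
    by_contra hne
    have h1 := minpoly.degree_le_of_ne_zero E (residue A x) hne (by
      rw [aeval_def, eval₂_map]
      have h2 : (algebraMap E (ResidueField A)).comp φ = (residue A).comp C.subtype := rfl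
      rw [h2, ← hom_eval₂]
      exact (residue_eq_zero_iff _).2 hPx)
    rw [hmin, degree_X_pow_sub_C hp.pos] at h1
    exact absurd (h1.trans degree_map_le) hP.not_ge
  have h1 := congrArg (fun Q => ((Q.coeff j : E) : ResidueField A)) h0
  simp only [coeff_map, coeff_zero] at h1
  exact (residue_eq_zero_iff _).1 h1

/-- The elements of `C` in the maximal ideal are generated, modulo the square of the maximal ideal,
by `t` elements, and the image of `C` in the residue field is spanned by `g` elements over the
`p`-th powers. -/
def GeneratorBound (p : ℕ) (C : Subring A) (t g : ℕ) : Prop :=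
  ∃ T : Finset A, T.card ≤ t ∧ (T : Set A) ⊆ maximalIdeal A ∧
    (∀ c ∈ C, c ∈ maximalIdeal A → c ∈ Ideal.span (T : Set A) ⊔ maximalIdeal A ^ 2) ∧
    ∃ z : Fin g → A, ∀ a ∈ C, ∃ c : Fin g → A, a - ∑ j, c j ^ p * z j ∈ maximalIdeal A

theorem generatorBound_range_frobenius : GeneratorBound p (frobenius A p).range 0 1 := by
  refine ⟨∅, le_rfl, by simp, ?_, fun _ => 1, ?_⟩
  · rintro _ ⟨c, rfl⟩ hc
    rw [frobenius_def] at hc ⊢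
    have h := Ideal.IsPrime.mem_of_pow_mem inferInstance _ hc
    exact Ideal.mem_sup_right (Ideal.pow_le_pow_right (Fact.out : p.Prime).two_le
      (Ideal.pow_mem_pow h p))
  · rintro _ ⟨c, rfl⟩
    exact ⟨fun _ => c, by simp [frobenius_def]⟩

/-- The effect of adjoining a `p`-th root on the bounds of `GeneratorBound`. -/
theorem GeneratorBound.adjoin {C : Subring A} (hC : (frobenius A p).range ≤ C) {t g : ℕ}
    (h : GeneratorBound p C t g) (x : A) :
    GeneratorBound p (eval₂RingHom C.subtype x).range (t + 1) g ∨
      GeneratorBound p (eval₂RingHom C.subtype x).range t (p * g) := by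
  classical
  obtain ⟨T, hTt, hTm, hT, z, hz⟩ := h
  by_cases hx : ∃ c ∈ C, x - c ∈ maximalIdeal A
  -- The residue field does not grow: the subring is generated over `C` by `x - c`, which is the one
  -- new generator of the maximal ideal.
  · left
    obtain ⟨c, hc, hxc⟩ := hx
    have key : ∀ a ∈ (eval₂RingHom C.subtype x).range, ∃ b ∈ C, ∃ r, a = b + r * (x - c) := by
      rintro _ ⟨P, rfl⟩
      refine ⟨(P.eval ⟨c, hc⟩ : C), (P.eval ⟨c, hc⟩ : C).2, ?_⟩
      obtain ⟨r, hr⟩ := sub_dvd_eval_sub x c (P.map C.subtype)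
      refine ⟨r, ?_⟩
      have h1 : (P.map C.subtype).eval c = (P.eval ⟨c, hc⟩ : C) := by
        rw [Polynomial.eval_map]
        exact (hom_eval₂ P (RingHom.id C) C.subtype ⟨c, hc⟩).symm
      rw [coe_eval₂RingHom, ← Polynomial.eval_map, ← h1, mul_comm, ← hr, add_sub_cancel]
    refine ⟨insert (x - c) T, (Finset.card_insert_le _ _).trans (by omega), ?_, ?_, z, ?_⟩
    · rw [Finset.coe_insert]
      exact Set.insert_subset hxc hTm
    · intro a ha ham
      obtain ⟨b, hb, r, rfl⟩ := key a ha
      have hbm : b ∈ maximalIdeal A :=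
        (Ideal.add_mem_iff_left _ (Ideal.mul_mem_left _ r hxc)).1 ham
      rw [Finset.coe_insert, Ideal.span_insert, sup_assoc, add_comm]
      exact Submodule.add_mem_sup (Ideal.mul_mem_left _ _ (Ideal.mem_span_singleton_self _))
        (hT b hb hbm)
    · intro a ha
      obtain ⟨b, hb, r, rfl⟩ := key a ha
      obtain ⟨d, hd⟩ := hz b hb
      refine ⟨d, ?_⟩
      rw [add_sub_right_comm]
      exact Ideal.add_mem _ hd (Ideal.mul_mem_left _ r hxc)
  -- The residue field grows by degree `p`: the powers of `x` multiply the spanning family, and the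
  -- maximal ideal gets no new generator since an element in it has all its coefficients in it.
  · right
    push Not at hx
    have hsum : ∀ P : C[X], P.degree < p →
        P.eval₂ C.subtype x = ∑ j : Fin p, (P.coeff j : A) * x ^ (j : ℕ) := by
      intro P hP
      rw [eval₂_eq_sum, ← sum_fin _ (by simp) hP]
      rfl
    refine ⟨T, hTt, hTm, ?_, ?_⟩
    · intro a ha ham
      obtain ⟨P, hP, rfl⟩ := exists_eval₂_of_pow_mem (p := p) (hC ⟨x, rfl⟩) ha
      have h1 := coeff_mem_maximalIdeal C hC hx hP ham
      rw [hsum P hP]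
      exact Ideal.sum_mem _ fun j _ => Ideal.mul_mem_right _ _ (hT _ (P.coeff j).2 (h1 j))
    · refine ⟨fun j => z (finProdFinEquiv.symm j).2 * x ^ ((finProdFinEquiv.symm j).1 : ℕ), ?_⟩
      intro a ha
      obtain ⟨P, hP, rfl⟩ := exists_eval₂_of_pow_mem (p := p) (hC ⟨x, rfl⟩) ha
      choose d hd using fun j : Fin p => hz _ (P.coeff j).2
      refine ⟨fun j => d (finProdFinEquiv.symm j).1 (finProdFinEquiv.symm j).2, ?_⟩
      rw [finProdFinEquiv.symm.sum_comp fun k : Fin p × Fin g =>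
        d k.1 k.2 ^ p * (z k.2 * x ^ (k.1 : ℕ)), hsum P hP]
      have h1 : ∑ j : Fin p, (P.coeff j : A) * x ^ (j : ℕ) -
          ∑ k : Fin p × Fin g, d k.1 k.2 ^ p * (z k.2 * x ^ (k.1 : ℕ)) =
          ∑ j : Fin p, ((P.coeff j : A) - ∑ l, d j l ^ p * z l) * x ^ (j : ℕ) := by
        simp [Fintype.sum_prod_type, sub_mul, Finset.sum_sub_distrib, Finset.sum_mul, mul_assoc]
      rw [h1]
      exact Ideal.sum_mem _ fun j _ => Ideal.mul_mem_right _ _ (hd j)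

/-- Each adjunction multiplies exactly one of the factors `p ^ t` and `g` by `p`, which keeps the
product equal to `p ^ i`. -/
theorem exists_generatorBound {n : ℕ} (x : Fin n → A) (i : ℕ) (hi : i ≤ n) :
    ∃ C : Subring A, (frobenius A p).range ≤ C ∧ (∀ j : Fin n, (j : ℕ) < i → x j ∈ C) ∧
      ∃ t g, p ^ t * g = p ^ i ∧ GeneratorBound p C t g := by
  induction i with
  | zero => exact ⟨_, le_rfl, by simp, 0, 1, by simp, generatorBound_range_frobenius⟩
  | succ i ih =>
    obtain ⟨C, hC, hxC, t, g, htg, h⟩ := ih (by omega)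
    have hle : C ≤ (eval₂RingHom C.subtype (x ⟨i, hi⟩)).range := fun c hc =>
      ⟨Polynomial.C ⟨c, hc⟩, by simp⟩
    refine ⟨_, hC.trans hle, fun j hj => ?_, ?_⟩
    · rcases Nat.lt_succ_iff_lt_or_eq.1 hj with hj | hj
      · exact hle (hxC j hj)
      · exact ⟨X, by subst hj; simp⟩
    · rcases h.adjoin hC (x ⟨i, hi⟩) with h | h
      · exact ⟨t + 1, g, by rw [pow_succ' p i, ← htg]; ring, h⟩
      · exact ⟨t, p * g, by rw [pow_succ' p i, ← htg]; ring, h⟩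

end PthRoots

/-! ### Freeness via Frobenius implies regularity -/

section Regular

open IsLocalRing TupledRing

variable {A : Type*} [CommRing A] {p : ℕ} [Fact p.Prime] [CharP A p]

theorem exists_pow_maximalIdeal_le [IsLocalRing A] [IsNoetherianRing A] {I : Ideal A}
    (hI : maximalIdeal A ∈ I.minimalPrimes) : ∃ t, maximalIdeal A ^ t ≤ I := by
  refine Ideal.exists_pow_le_of_le_radical_of_fg ?_ (IsNoetherian.noetherian _)
  rw [Ideal.radical_eq_sInf]
  refine le_sInf fun J hJ => ?_
  exact hI.2 ⟨hJ.2, hJ.1⟩ (le_maximalIdeal hJ.2.ne_top)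

/-- A Noetherian local ring which is free over itself via Frobenius, on the restricted monomials
in a tuple of elements, is regular. -/
theorem isRegularLocalRing_of_expand_bijective [IsLocalRing A] [IsNoetherianRing A] {n : ℕ}
    (x : Fin n → A) (h : Function.Bijective (expand (p := p) (frobenius A p) x)) :
    IsRegularLocalRing A := by
  classical
  have hp : p.Prime := Fact.out
  obtain ⟨C, hC, hxC, t, g, htg, T, hTt, hTm, hT, z, hz⟩ :=
    exists_generatorBound (p := p) x n le_rfl
  have hC' : C = ⊤ := by
    refine eq_top_iff.2 fun a _ => ?_
    obtain ⟨c, rfl⟩ := h.2 a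
    exact C.sum_mem fun b _ => C.mul_mem (hC ⟨c b, rfl⟩)
      (C.prod_mem fun i _ => C.pow_mem (hxC i i.2) _)
  subst hC'
  -- Nakayama: generation modulo the square suffices.
  have hspan : maximalIdeal A = Ideal.span (T : Set A) := by
    refine le_antisymm ?_ (Ideal.span_le.2 hTm)
    refine Submodule.le_of_le_smul_of_le_jacobson_bot (I := maximalIdeal A)
      (IsNoetherian.noetherian _) (maximalIdeal_le_jacobson _) fun a ha => ?_
    have := hT a trivial ha
    rwa [pow_two] at this
  have hg : SpansModulo (frobenius A p) ⊤ (maximalIdeal A) g :=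
    ⟨z, fun a _ => hz a trivial⟩
  -- `Y` is a system of parameters. A power of the maximal ideal lies in its span, and the `p ^
  -- e`-th powers of its elements lie in the extension of the maximal ideal along the `e`-th
  -- Frobenius.
  obtain ⟨Y, hYm, hYd⟩ := Ideal.exists_finset_card_eq_height_of_isNoetherianRing (maximalIdeal A)
  obtain ⟨s, hs⟩ := exists_pow_maximalIdeal_le hYm
  obtain ⟨D, hD⟩ := SpansModulo.exists_pow (maximalIdeal A) s
  have hfree : (frobenius A p).IsFreeOn
      (restrictedMonomial x : (Fin n → Fin p) → A) := h
  have hbound : ∀ e, (p ^ n) ^ e ≤ D * (p ^ Y.card * g) ^ e := by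
    intro e
    obtain ⟨κ, _, w, hκ, hw⟩ := hfree.exists_iterate e
    have h1 : SpansModulo (frobenius A p ^ e) ⊤ (⊥ ⊔ Ideal.span (Y : Set A)) (D * g ^ e) := by
      rw [bot_sup_eq]
      exact (hD _ _ (hg.iterate (fun a ha => Ideal.pow_mem_of_mem _ ha _ hp.pos) e)).mono_right hs
    have h2 : SpansModulo (frobenius A p ^ e) ⊤
        ((maximalIdeal A).map (frobenius A p ^ e)) ((p ^ e) ^ Y.card * (D * g ^ e)) := by
      refine (h1.sup_span_pow_finset (p ^ e) Y).mono_right ?_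
      rw [bot_sup_eq, Ideal.span_le]
      rintro _ ⟨y, hy, rfl⟩
      have h3 : (frobenius A p ^ e) y = y ^ p ^ e := by
        rw [RingHom.coe_pow]
        exact iterate_frobenius p e y
      have h4 := Ideal.mem_map_of_mem (frobenius A p ^ e) (hYm.1.2 (Ideal.subset_span hy))
      rwa [h3] at h4
    have h3 := hw.card_le h2
    rw [hκ, Fintype.card_fun, Fintype.card_fin, Fintype.card_fin] at h3
    refine h3.trans_eq ?_
    rw [mul_pow, ← pow_mul, ← pow_mul, mul_comm e]
    ring
  have hle := Nat.le_of_forall_pow_le_mul_pow hbound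
  rw [← htg] at hle
  have hgpos : 0 < g := by
    rcases Nat.eq_zero_or_pos g with rfl | h0
    · rw [mul_zero] at htg
      exact absurd htg (Nat.pow_pos hp.pos).ne
    · exact h0
  have htY : t ≤ Y.card :=
    (Nat.pow_le_pow_iff_right hp.one_lt).1 (Nat.le_of_mul_le_mul_right hle hgpos)
  apply IsRegularLocalRing.of_spanFinrank_maximalIdeal_le
  rw [← maximalIdeal_height_eq_ringKrullDim, ← hYd]
  have h1 : (maximalIdeal A).spanFinrank ≤ T.card := by
    rw [hspan]
    exact (Submodule.spanFinrank_span_le_ncard_of_finite T.finite_toSet).trans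
      (Set.ncard_coe_finset T).le
  exact_mod_cast h1.trans (hTt.trans htY)

/-- Freeness via Frobenius on restricted monomials passes to localizations. -/
theorem expand_frobenius_bijective_of_isLocalization {n : ℕ} (x : Fin n → A)
    (h : Function.Bijective (expand (p := p) (frobenius A p) x)) (M : Submonoid A) (B : Type*)
    [CommRing B] [Algebra A B] [IsLocalization M B] [CharP B p] :
    Function.Bijective (expand (p := p) (frobenius B p) fun i => algebraMap A B (x i)) := by
  have hp : p.Prime := Fact.out
  -- Coordinates with common denominator `s` expand to an element with denominator `s ^ p`;
  -- conversely, `a / s` is rewritten below as `a * s ^ (p - 1) / s ^ p`.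
  have hfrac : ∀ (c : (Fin n → Fin p) → A) (s : M),
      expand (frobenius B p) (fun i => algebraMap A B (x i)) (fun b => IsLocalization.mk' B (c b) s)
        * algebraMap A B (s ^ p) = algebraMap A B (expand (frobenius A p) x c) := by
    intro c s
    rw [map_expand (frobenius A p) x (frobenius B p) (algebraMap A B) (algebraMap A B)
      fun a => map_pow _ _ _]
    rw [expand, expand, Finset.sum_mul]
    refine Finset.sum_congr rfl fun b _ => ?_
    rw [frobenius_def, frobenius_def, mul_right_comm, map_pow, ← mul_pow, IsLocalization.mk'_spec]
  refine ⟨expand_injective_of_zero _ _ fun c hc => ?_, fun a => ?_⟩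
  · obtain ⟨s, hs⟩ := IsLocalization.exist_integer_multiples_of_finite M c
    choose d hd using hs
    have hcd : c = fun b => IsLocalization.mk' B (d b) s := by
      funext b
      rw [eq_comm, IsLocalization.mk'_eq_iff_eq_mul, hd b, Algebra.smul_def, mul_comm]
    have h1 := hfrac d s
    rw [← hcd, hc, zero_mul] at h1
    obtain ⟨m, hm⟩ := (IsLocalization.map_eq_zero_iff M B _).1 h1.symm
    have h2 : expand (frobenius A p) x (fun b => (m : A) * d b) = 0 := by
      have h3 : expand (frobenius A p) x (fun b => (m : A) * d b) =
          (m : A) ^ p * expand (frobenius A p) x d := by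
        simp [expand, Finset.mul_sum, frobenius_def, mul_pow, mul_assoc]
      have h4 : (m : A) ^ p = (m : A) ^ (p - 1) * m := by
        rw [← pow_succ, Nat.sub_add_cancel hp.pos]
      rw [h3, h4, mul_assoc, hm, mul_zero]
    have h5 := h.1 (a₂ := 0) (h2.trans (by simp [expand, frobenius_def, hp.ne_zero]))
    funext b
    rw [hcd]
    exact (IsLocalization.mk'_eq_zero_iff _ _).2 ⟨m, congrFun h5 b⟩
  · obtain ⟨a, s, rfl⟩ := IsLocalization.exists_mk'_eq M a
    obtain ⟨c, hc⟩ := h.2 (a * s ^ (p - 1))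
    refine ⟨fun b => IsLocalization.mk' B (c b) s, ?_⟩
    have h1 := hfrac c s
    rw [hc] at h1
    refine (IsLocalization.map_units B (s ^ p)).mul_right_cancel ?_
    rw [SubmonoidClass.coe_pow, h1]
    have h2 : (s : A) ^ p = s * (s : A) ^ (p - 1) := by
      rw [← pow_succ', Nat.sub_add_cancel hp.pos]
    rw [h2, map_mul, map_mul, ← mul_assoc, IsLocalization.mk'_spec]

theorem isRegularRing_of_expand_bijective [IsNoetherianRing A] {n : ℕ}
    (x : Fin n → A) (h : Function.Bijective (expand (p := p) (frobenius A p) x)) :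
    IsRegularRing A := by
  refine isRegularRing_iff.2 fun P _ => ?_
  have : CharP (Localization.AtPrime P) p := by
    refine (CharP.charP_iff_prime_eq_zero Fact.out).2 ?_
    rw [← map_natCast (algebraMap A (Localization.AtPrime P)), CharP.cast_eq_zero, map_zero]
  have : IsNoetherianRing (Localization.AtPrime P) :=
    IsLocalization.isNoetherianRing P.primeCompl _ inferInstance
  exact isRegularLocalRing_of_expand_bijective _
    (expand_frobenius_bijective_of_isLocalization x h P.primeCompl (Localization.AtPrime P))

end Regular

/-! ### Regular rings are reduced -/

section RegularDomain

open IsLocalRing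

/-- Prime avoidance, which tolerates the non-prime ideal `m ^ 2`: Nakayama excludes `m ≤ m ^ 2`, and
positive dimension excludes that `m` is a minimal prime. -/
theorem exists_notMem_sq_of_isRegularLocalRing {A : Type*} [CommRing A] [IsRegularLocalRing A]
    (h : (maximalIdeal A).spanFinrank ≠ 0) :
    ∃ x ∈ maximalIdeal A, x ∉ maximalIdeal A ^ 2 ∧ ∀ P ∈ minimalPrimes A, x ∉ P := by
  have hA := (isRegularLocalRing_iff A).1 inferInstance
  by_contra! hcon
  have hcov : (maximalIdeal A : Set A) ⊆
      ⋃ I ∈ insert (maximalIdeal A ^ 2) (minimalPrimes A), (I : Set A) := by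
    intro x hx
    rw [Set.biUnion_insert]
    by_cases hx2 : x ∈ maximalIdeal A ^ 2
    · exact Or.inl hx2
    · obtain ⟨P, hP, hxP⟩ := hcon x hx hx2
      exact Or.inr (Set.mem_biUnion hP hxP)
  obtain ⟨I, hI, hle⟩ := (Ideal.subset_union_prime_finite
    ((minimalPrimes.finite_of_isNoetherianRing A).insert _) (f := id)
    (maximalIdeal A ^ 2) (maximalIdeal A ^ 2) (by
      rintro I (rfl | hI) h1 _
      · exact absurd rfl h1
      · exact hI.1.1)).1 hcov
  rcases hI with rfl | hI
  · refine h ((Submodule.spanFinrank_eq_zero_iff_eq_bot (IsNoetherian.noetherian _)).2 ?_)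
    refine Submodule.eq_bot_of_le_smul_of_le_jacobson_bot (maximalIdeal A) _
      (IsNoetherian.noetherian _) ?_ (maximalIdeal_le_jacobson _)
    rwa [id, pow_two] at hle
  · have hIp : I.IsPrime := hI.1.1
    have h1 : maximalIdeal A = I := le_antisymm hle (le_maximalIdeal hIp.ne_top)
    have h2 : (maximalIdeal A).height = 0 := Ideal.height_eq_zero_iff.2 (h1 ▸ hI)
    rw [← maximalIdeal_height_eq_ringKrullDim, h2] at hA
    exact h (by exact_mod_cast hA)

/-- Written in minimal generators, `x` has a unit coefficient, for otherwise it would lie in the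
square; modulo `x` that generator is redundant. -/
theorem spanFinrank_maximalIdeal_quotient_le {A : Type*} [CommRing A] [IsLocalRing A]
    [IsNoetherianRing A] {x : A} (hx : x ∈ maximalIdeal A) (hx2 : x ∉ maximalIdeal A ^ 2)
    [IsLocalRing (A ⧸ Ideal.span {x})] :
    (maximalIdeal (A ⧸ Ideal.span {x})).spanFinrank + 1 ≤ (maximalIdeal A).spanFinrank := by
  have hfg : (maximalIdeal A).FG := IsNoetherian.noetherian _
  have hfin := Submodule.FG.finite_generators hfg
  obtain ⟨G, hG⟩ := hfin.exists_finset_coe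
  have hcard : G.card = (maximalIdeal A).spanFinrank := by
    rw [← Submodule.FG.generators_ncard hfg, ← hG, Set.ncard_coe_finset]
  have hspan : Ideal.span (G : Set A) = maximalIdeal A :=
    hG ▸ (maximalIdeal A).span_generators
  classical
  obtain ⟨c, -, hc⟩ := Submodule.mem_span_finset.1
    (show x ∈ Ideal.span (G : Set A) by rwa [hspan])
  have hunit : ∃ g ∈ G, IsUnit (c g) := by
    by_contra! hcon
    refine hx2 (hc ▸ Ideal.sum_mem _ fun g hg => ?_)
    rw [pow_two]
    exact Ideal.mul_mem_mul (hcon g hg) (hspan ▸ Ideal.subset_span hg)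
  obtain ⟨g, hg, hu⟩ := hunit
  let π := Ideal.Quotient.mk (Ideal.span {x})
  have hπ : maximalIdeal (A ⧸ Ideal.span {x}) = Ideal.span (π '' (G.erase g : Finset A)) := by
    rw [← map_maximalIdeal_of_surjective π Ideal.Quotient.mk_surjective, ← hspan, Ideal.map_span]
    refine le_antisymm (Ideal.span_le.2 ?_)
      (Ideal.span_mono (Set.image_mono (Finset.erase_subset _ _)))
    rintro _ ⟨k, hk, rfl⟩
    by_cases hkg : k = g
    · subst hkg
      have h0 : π x = 0 := Ideal.Quotient.eq_zero_iff_mem.2 (Ideal.mem_span_singleton_self x)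
      replace h0 := (congrArg π hc).trans h0
      rw [← Finset.add_sum_erase _ _ hg, map_add, smul_eq_mul, map_mul] at h0
      refine (Ideal.unit_mul_mem_iff_mem _ (hu.map π)).1 ?_
      rw [eq_neg_of_add_eq_zero_left h0, map_sum]
      refine Submodule.neg_mem _ (Ideal.sum_mem _ fun l hl => ?_)
      rw [smul_eq_mul, map_mul]
      exact Ideal.mul_mem_left _ _ (Ideal.subset_span (Set.mem_image_of_mem π hl))
    · exact Ideal.subset_span (Set.mem_image_of_mem π (Finset.mem_erase.2 ⟨hkg, hk⟩))
  rw [hπ, ← hcard, ← Finset.card_erase_add_one hg]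
  refine Nat.add_le_add_right ?_ 1
  refine (Submodule.spanFinrank_span_le_ncard_of_finite
    ((G.erase g).finite_toSet.image π)).trans ?_
  exact (Set.ncard_image_le (G.erase g).finite_toSet).trans (Set.ncard_coe_finset _).le

/-- A regular local ring is a domain. -/
theorem IsRegularLocalRing.isDomain_of_spanFinrank (n : ℕ) :
    ∀ (A : Type u) [CommRing A] [IsRegularLocalRing A],
      (maximalIdeal A).spanFinrank = n → IsDomain A := by
  induction n with
  | zero =>
    intro A _ _ h
    have h0 : maximalIdeal A = ⊥ :=
      (Submodule.spanFinrank_eq_zero_iff_eq_bot (IsNoetherian.noetherian _)).1 h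
    exact (isField_iff_maximalIdeal_eq.2 h0).isDomain
  | succ n ih =>
    intro A _ _ h
    obtain ⟨x, hx, hx2, hxP⟩ := exists_notMem_sq_of_isRegularLocalRing (A := A) (by omega)
    have hne : Ideal.span {x} ≠ ⊤ := fun h1 =>
      (maximalIdeal.isMaximal A).ne_top (top_le_iff.1
        (h1 ▸ (Ideal.span_singleton_le_iff_mem _).2 hx))
    have : Nontrivial (A ⧸ Ideal.span {x}) := Ideal.Quotient.nontrivial_iff.2 hne
    have : IsLocalRing (A ⧸ Ideal.span {x}) :=
      .of_surjective' (Ideal.Quotient.mk _) Ideal.Quotient.mk_surjective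
    have hle := spanFinrank_maximalIdeal_quotient_le hx hx2
    have hdim : ((maximalIdeal (A ⧸ Ideal.span {x})).spanFinrank : WithBot ℕ∞) ≤
        ringKrullDim (A ⧸ Ideal.span {x}) := by
      have h1 := Ideal.height_le_ringKrullDim_quotient_add_one hx
      rw [maximalIdeal_height_eq_ringKrullDim, ← (isRegularLocalRing_iff A).1 inferInstance,
        ← maximalIdeal_height_eq_ringKrullDim] at h1
      rw [← maximalIdeal_height_eq_ringKrullDim]
      have h2 : ((maximalIdeal A).spanFinrank : ℕ∞) ≤
          (maximalIdeal (A ⧸ Ideal.span {x})).height + 1 := by exact_mod_cast h1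
      have h3 : ((maximalIdeal (A ⧸ Ideal.span {x})).spanFinrank : ℕ∞) + 1 ≤
          (maximalIdeal (A ⧸ Ideal.span {x})).height + 1 := le_trans (by exact_mod_cast hle) h2
      exact_mod_cast (ENat.add_le_add_iff_right ENat.one_ne_top).1 h3
    have hreg : IsRegularLocalRing (A ⧸ Ideal.span {x}) := .of_spanFinrank_maximalIdeal_le _ hdim
    have hn : (maximalIdeal (A ⧸ Ideal.span {x})).spanFinrank = n := by
      have h1 := Ideal.height_le_ringKrullDim_quotient_add_one hx
      rw [maximalIdeal_height_eq_ringKrullDim, ← (isRegularLocalRing_iff A).1 inferInstance,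
        ← (isRegularLocalRing_iff _).1 hreg] at h1
      have h2 : (maximalIdeal A).spanFinrank ≤
        (maximalIdeal (A ⧸ Ideal.span {x})).spanFinrank + 1 := by exact_mod_cast h1
      omega
    have hdom := ih (A ⧸ Ideal.span {x}) hn
    have hprime : (Ideal.span {x}).IsPrime := (Ideal.Quotient.isDomain_iff_prime _).1 hdom
    obtain ⟨P, hP, hPx⟩ := Ideal.exists_minimalPrimes_le (bot_le (a := Ideal.span {x}))
    have hPp : P.IsPrime := hP.1.1
    -- A minimal prime `P` inside `(x)` that does not contain `x` satisfies `P = x P`, so it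
    -- vanishes by Nakayama.
    have hP0 : P = ⊥ := by
      refine Submodule.eq_bot_of_le_smul_of_le_jacobson_bot (Ideal.span {x}) P
        (IsNoetherian.noetherian _) (fun y hy => ?_)
        (((Ideal.span_singleton_le_iff_mem _).2 hx).trans (maximalIdeal_le_jacobson _))
      obtain ⟨z, rfl⟩ := Ideal.mem_span_singleton.1 (hPx hy)
      have hz : z ∈ P := (hPp.mem_or_mem hy).resolve_left (hxP P hP)
      exact Ideal.mul_mem_mul (Ideal.mem_span_singleton_self x) hz
    subst hP0
    exact IsDomain.of_bot_isPrime A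

theorem IsRegularRing.isReduced (A : Type u) [CommRing A] [IsRegularRing A] : IsReduced A := by
  refine isReduced_ofLocalizationMaximal A fun J hJ => ?_
  have := IsRegularLocalRing.isDomain_of_spanFinrank _ (Localization.AtPrime J) rfl
  infer_instance

end RegularDomain

/-! ### The universal property and the adjunction -/

namespace TupledRing

variable {p : ℕ} [Fact p.Prime]

theorem gabberMap_counit {X Y : TupledRing.{u} p} (f : X ⟶ Y) :
    gabberMap f ≫ Y.gabberCounit = X.gabberCounit ≫ f :=
  rfl

theorem gabberProj_succ_pow (Y : TupledRing.{u} p) (i : ℕ) (a : Y.gabberRing) :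
    Y.gabberProj (i + 1) (a ^ p) = Y.stageC i (Y.gabberProj i a) := by
  rw [← Y.transition_gabberProj i a, stageC_transition, map_pow]

/-- A morphism from `(S; y)` with `S = S^p[y]` to `G(R; x)` is determined by its composition with
the projection to `(R; x)`. -/
theorem hom_gabber_ext {Z Y : TupledRing.{u} p} (hZ : Function.Surjective Z.rootPhi)
    {f g : Z ⟶ Y.gabber} (h : f ≫ Y.gabberCounit = g ≫ Y.gabberCounit) : f = g := by
  have hidx : f.idx = g.idx :=
    congrArg (Hom.idx : (Z ⟶ Y) → _) h
  have h0 : ∀ a, Y.gabberProj 0 (f.ringHom a) = Y.gabberProj 0 (g.ringHom a) := fun a =>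
    RingHom.congr_fun (congrArg (Hom.ringHom : (Z ⟶ Y) → _) h) a
  -- Every element of `Z` is a combination of restricted monomials with `p`-th powers as
  -- coefficients, so the images of the `c b` in `R_i` determine its image in `R_{i+1}`; this drives
  -- the induction.
  have hexp : ∀ (f : Z ⟶ Y.gabber) (i : ℕ) (c : (Fin Z.len → Fin p) → Z.carrier),
      Y.gabberProj (i + 1) (f.ringHom (expand (frobenius Z.carrier p) Z.gen c)) =
        expand (Y.stageC i) (fun k => Y.stageGen (i + 1) (f.idx k))
          (fun b => Y.gabberProj i (f.ringHom (c b))) := by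
    intro f i c
    refine (map_expand _ _ (Y.stageC i) ((Y.gabberProj (i + 1)).comp f.ringHom)
      (fun a => Y.gabberProj i (f.ringHom a)) (fun a => ?_) c).trans ?_
    · rw [RingHom.comp_apply, frobenius_def, map_pow, gabberProj_succ_pow]
    · refine congrArg (fun x => expand _ x _) (funext fun k => ?_)
      rw [RingHom.comp_apply, f.map_gen]
      rfl
  refine hom_ext (RingHom.ext fun a => Subtype.ext (funext fun i => ?_)) hidx
  change Y.gabberProj i (f.ringHom a) = Y.gabberProj i (g.ringHom a)
  induction i generalizing a with
  | zero => exact h0 a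
  | succ i ih =>
    obtain ⟨b, rfl⟩ := hZ a
    obtain ⟨c, rfl⟩ := Z.expand_root_bijective.2 b
    rw [rootPhi_expand, hexp, hexp, hidx]
    exact congrArg _ (funext fun b => ih _)

theorem gabberProj_zero_bijective {Z : TupledRing.{u} p} (hZ : Function.Bijective Z.rootPhi) :
    Function.Bijective (Z.gabberProj 0) :=
  ⟨Z.gabberProj_zero_injective hZ.1, Z.gabberProj_surjective hZ.2 0⟩

/-- If `φ` is bijective, the ring `G(S; y)` is isomorphic to `S`. -/
def gabberRingEquiv (Z : TupledRing.{u} p) (hZ : Function.Bijective Z.rootPhi) :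
    Z.gabberRing ≃+* Z.carrier :=
  RingEquiv.ofBijective Z.gabberCounit.ringHom (gabberProj_zero_bijective hZ)

/-- If `φ` is bijective, the projection `G(S; y) → (S; y)` is an isomorphism. -/
def gabberCounitIso (Z : TupledRing.{u} p) (hZ : Function.Bijective Z.rootPhi) :
    Z.gabber ≅ Z where
  hom := Z.gabberCounit
  inv :=
    { ringHom := (Z.gabberRingEquiv hZ).symm.toRingHom
      idx := id
      map_gen := fun _ => (Z.gabberRingEquiv hZ).symm_apply_eq.2 rfl }
  hom_inv_id := hom_ext (RingHom.ext (Z.gabberRingEquiv hZ).symm_apply_apply) rfl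
  inv_hom_id := hom_ext (RingHom.ext (Z.gabberRingEquiv hZ).apply_symm_apply) rfl

theorem isPGens_gabber {X : TupledRing.{u} p} (hX : isPGens.{u} p X) :
    isPGens.{u} p X.gabber := by
  have : IsNoetherianRing X.carrier := hX.1
  exact ⟨X.isNoetherianRing_gabber (X.rootPhi_surjective hX.2.2),
    finite_of_expand X.gabber_expand_bijective.2,
    X.gabber.isPGenerating_of_expand X.gabber_expand_bijective.2⟩

end TupledRing

open TupledRing

variable {p : ℕ} [Fact p.Prime]

theorem isRegularPBasis_gabber (X : RingPGens.{u} p) :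
    isRegularPBasis.{u} p ⟨X.obj.gabber, isPGens_gabber X.property⟩ := by
  have : IsNoetherianRing X.obj.gabberRing := (isPGens_gabber X.property).1
  have h := X.obj.gabber_expand_bijective
  exact ⟨isRegularRing_of_expand_bijective _ h, X.obj.gabber.isPIndependent_of_expand h.1,
    X.obj.gabber.isPGenerating_of_expand h.2⟩

theorem rootPhi_bijective_of_isRegularPBasis (Z : RegRingPBasis.{u} p) :
    Function.Bijective Z.obj.obj.rootPhi := by
  have : IsRegularRing Z.obj.obj.carrier := Z.property.1
  have : IsReduced Z.obj.obj.carrier := IsRegularRing.isReduced _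
  exact ⟨Z.obj.obj.rootPhi_injective Z.property.2.1,
    Z.obj.obj.rootPhi_surjective Z.property.2.2⟩

/-- Gabber's functor from rings with `p`-generators to regular rings with `p`-basis. -/
abbrev gabberRegFunctor (p : ℕ) [Fact p.Prime] : RingPGens.{u} p ⥤ RegRingPBasis.{u} p :=
  gabberReg (fun X => isPGens_gabber X.property) isRegularPBasis_gabber

/-- The projections `G(R; x) → (R; x)` as a natural transformation. -/
def gabberCounitTrans (p : ℕ) [Fact p.Prime] :
    gabberRegFunctor.{u} p ⋙ (isRegularPBasis.{u} p).ι ⟶ 𝟭 (RingPGens.{u} p) where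
  app X := ObjectProperty.homMk X.obj.gabberCounit
  naturality _ _ f := ObjectProperty.hom_ext _ (gabberMap_counit f.hom)

/-- A regular ring with `p`-basis is isomorphic to its image under Gabber's functor. -/
def gabberUnitIso (p : ℕ) [Fact p.Prime] :
    𝟭 (RegRingPBasis.{u} p) ≅ (isRegularPBasis.{u} p).ι ⋙ gabberRegFunctor.{u} p :=
  (NatIso.ofComponents
    (fun Z => ObjectProperty.isoMk _ (ObjectProperty.isoMk _
      (gabberCounitIso Z.obj.obj (rootPhi_bijective_of_isRegularPBasis Z))))
    fun {Z W : RegRingPBasis.{u} p} (f : Z ⟶ W) => ObjectProperty.hom_ext _ (ObjectProperty.hom_ext _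
      (gabberMap_counit f.hom.hom))).symm

/-- Gabber's functor is right adjoint to the inclusion of regular rings with `p`-basis into rings
with `p`-generators. -/
def gabberAdjunction (p : ℕ) [Fact p.Prime] :
    (isRegularPBasis.{u} p).ι ⊣ gabberRegFunctor.{u} p where
  unit := (gabberUnitIso p).hom
  counit := gabberCounitTrans p
  left_triangle_components Z := ObjectProperty.hom_ext _
    (gabberCounitIso Z.obj.obj (rootPhi_bijective_of_isRegularPBasis Z)).inv_hom_id
  right_triangle_components X := by
    refine ObjectProperty.hom_ext _ (ObjectProperty.hom_ext _ ?_)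
    have hZ := rootPhi_bijective_of_isRegularPBasis ((gabberRegFunctor p).obj X)
    -- By uniqueness it is enough to compare after projecting to `R`, where naturality of the
    -- projection moves it past the inverse.
    refine hom_gabber_ext (Z := X.obj.gabber) (Y := X.obj) hZ.2 ?_
    change ((gabberCounitIso X.obj.gabber hZ).inv ≫ gabberMap X.obj.gabberCounit) ≫
      X.obj.gabberCounit = 𝟙 X.obj.gabber ≫ X.obj.gabberCounit
    rw [Category.assoc, gabberMap_counit, ← Category.assoc]
    exact congrArg (· ≫ X.obj.gabberCounit) (gabberCounitIso X.obj.gabber hZ).inv_hom_id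

theorem mainTheorem11 (p : ℕ) [Fact p.Prime] :
    ∃ (h : ∀ X : RingPGens.{u} p, TupledRing.isPGens.{u} p X.obj.gabber)
      (h' : ∀ X : RingPGens.{u} p, isRegularPBasis.{u} p ⟨X.obj.gabber, h X⟩)
      (adj : (isRegularPBasis.{u} p).ι ⊣ gabberReg h h'),
      IsIso adj.unit ∧
      (∀ X : RingPGens.{u} p, (adj.counit.app X).hom = X.obj.gabberCounit) ∧
      (∀ X : RingPGens.{u} p, Function.Surjective (adj.counit.app X).hom.ringHom) ∧
      (gabberReg h h').EssSurj := by
  refine ⟨fun X => isPGens_gabber X.property, isRegularPBasis_gabber, gabberAdjunction p,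
    (gabberUnitIso p).isIso_hom, fun X => rfl, fun X => ?_,
    ⟨fun Z => ⟨Z.obj, ⟨((gabberUnitIso p).app Z).symm⟩⟩⟩⟩
  exact X.obj.gabberProj_surjective (X.obj.rootPhi_surjective X.property.2.2) 0

end
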